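/- **Setting.** Work in a frame fixed in a rigid body, with coordinate $l\in\mathbb{R}^3$. Let $B$ be a nonempty compact body with smooth boundary $\Sigma_b=\partial B$, of uniform density $\rho>0$ equal to that of the fluid, and with center of mass at the origin. Let $W\supset B$ be the open region below the free surface $\Sigma_f=\partial W$; $\Sigma_f$ is smooth, $W$ lies on one side of it, is bounded above and infinitely deep in the vertical direction $k$, and the elevation $k\cdot l$ of $\Sigma_f$ tends to a constant $\eta_0$ at infinity. The fluid domain $D=W\setminus B$ is connected. Let $n_b$ be the unit normal of $\Sigma_b$ pointing into $D$ and $n_f$ the unit normal of $\Sigma_f$ pointing out of $D$; $\nu$ is surface area. All potentials are smooth up to the boundary. *Mixed problem.* For $u=(V,\Omega)\in\mathbb{R}^6$ and $\varphi$ in the space $\mathcal{F}$ of smooth functions on $\Sigma_f$ that tend to $0$ at infinity: $\nabla^2\Phi=0$ in $D$, $\Phi=\varphi$ on $\Sigma_f$, $\nabla\Phi\cdot n_b=(V+\Omega\times l)\cdot n_b$ on $\Sigma_b$, $\Phi\to0$ at infinity in $D$. It is assumed that this problem has exactly one solution for all $u$ and all $\varphi\in\mathcal{F}$. For $u=0$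 denote the solution by $L_S\varphi$, and let $L_{S,b}\varphi$ be its restriction to $\Sigma_b$. *Kirchhoff problem.* Let $\Psi_1,\dots,\Psi_6$ be the unit Kirchhoff potentials: $\nabla^2\Psi_i=0$ in $\mathbb{R}^3\setminus B$, $\nabla\Psi_i\cdot n_b=(V+\Omega\times l)\cdot n_b$ on $\Sigma_b$ with $(V,\Omega)=e_i$ the $i$-th standard basis vector of $\mathbb{R}^6$, and $\Psi_i\to0$ at infinity. Put $L_Ku=\sum_iu_i\Psi_i$ and let $L_{K,b}u$, $L_{K,f}u$ be its restrictions to $\Sigma_b$, $\Sigma_f$. Let $I_B\Phi=\bigl(-\int_{\Sigma_b}\Phi\,n_b\,\nu,\ -\int_{\Sigma_b}l\times\Phi\,n_b\,\nu\bigr)$, $I_F\varphi=\bigl(\int_{\Sigma_f}\varphi\,n_f\,\nu,\ \int_{\Sigma_f}l\times\varphi\,n_f\,\nu\bigr)$. Let $M_b$ be the block-diagonal $6\times6$ matrix with blocks $\mathrm{vol}(B)\,I_3$ and the inertia tensor $\int_B(|l|^2I_3-l\,l^{T})\,dl$. Let $M_a$ and $M_c$ be the matrices in the standard basis of the maps $I_B\circ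 L_{K,b}$ and $-I_B\circ L_{S,b}\circ L_{K,f}$ from $\mathbb{R}^6$ to $\mathbb{R}^6$. The momenta are $(\mathfrak{L},\mathfrak{A})=\rho M_b(V,\Omega)+\rho\,(I_B\Phi+I_F\varphi)$. Say that a variation $(\delta\varphi,\delta\mathfrak{L},\delta\mathfrak{A})$ is *possible* if there are $\delta u\in\mathbb{R}^6$ and a solution $\delta\Phi$ of the mixed problem with data $(\delta u,\delta\varphi)$ such that $(\delta\mathfrak{L},\delta\mathfrak{A})=\rho M_b\,\delta u+\rho\,(I_B\delta\Phi+I_F\delta\Phi)$. Fix a state: a solution $\Phi$ of the mixed problem for some $u_0\in\mathbb{R}^6$ and $\varphi_0\in\mathcal{F}$. Say that *independent variations of* $(\Sigma_f,\varphi_f,\mathfrak{L},\mathfrak{A})$ *are possible* at this state if all the following are possible: 1. $(0,\delta\mathfrak{L},0)$ for every $\delta\mathfrak{L}\in\mathbb{R}^3$, and $(0,0,\delta\mathfrak{A})$ for every $\delta\mathfrak{A}\in\mathbb{R}^3$; 2. $(\delta\varphi,0,0)$ for every $\delta\varphi\in\mathcal{F}$ for which the integrals $I_F\delta\varphi$ converge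 absolutely; 3. $(-\nabla\Phi\cdot(\delta s\,n_f)|_{\Sigma_f},0,0)$ for every smooth normal displacement $\delta s$ of $\Sigma_f$ for which this first entry is in $\mathcal{F}$ and its integrals $I_F$ converge absolutely. **Claim.** $M_au=I_B(L_{K,b}u)$ and $M_cu=-I_B(L_{S,b}L_{K,f}u)$ for all $u\in\mathbb{R}^6$. The matrices $M_a$, $M_c$ and $M:=M_b+M_a+M_c$ are symmetric. At any state, independent variations of $(\Sigma_f,\varphi_f,\mathfrak{L},\mathfrak{A})$ are possible if and only if $M$ is invertible. -/

import Mathlib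

open MeasureTheory Filter Topology Set
open scoped ContDiff RealInnerProductSpace

noncomputable section

namespace FreeSurfaceBody

/-- Physical space, in body-fixed coordinates. -/
abbrev Space : Type := EuclideanSpace ℝ (Fin 3)

/-- Index type of the six components of a pair (linear part, angular part):
`Sum.inl` for the linear components, `Sum.inr` for the angular ones. -/
abbrev Idx : Type := Fin 3 ⊕ Fin 3

/-- The cross product of two vectors of Euclidean 3-space. -/
def cross (a b : Space) : Space :=
  WithLp.toLp 2 (crossProduct (WithLp.ofLp a) (WithLp.ofLp b))

/-- The rigid velocity field `l ↦ V + Ω × l` of `u = (V, Ω)`. -/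
def rigidVelocity (u : Idx → ℝ) (l : Space) : Space :=
  WithLp.toLp 2 (fun i => u (Sum.inl i)) + cross (WithLp.toLp 2 (fun i => u (Sum.inr i))) l

/-- The six components of `(n, l × n)`. -/
def wrench (n l : Space) : Idx → ℝ :=
  Sum.elim (fun i => n i) (fun i => cross l n i)

/-! ### Smooth domains, unit normals, surface measure -/

/-- `r` is a smooth defining function of `Ω` near the boundary point `p`: near `p`, the set `Ω` is
`{r < 0}`, and the gradient of `r` does not vanish at `p`. -/
def IsDefiningFunction (Ω : Set Space) (p : Space) (r : Space → ℝ) : Prop :=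
  ContDiff ℝ ∞ r ∧ r p = 0 ∧ gradient r p ≠ 0 ∧ ∀ᶠ x in 𝓝 p, (x ∈ Ω ↔ r x < 0)

/-- An open set with smooth boundary, lying locally on one side of its boundary. -/
def IsSmoothDomain (Ω : Set Space) : Prop :=
  IsOpen Ω ∧ ∀ p ∈ frontier Ω, ∃ r, IsDefiningFunction Ω p r

open Classical in
/-- The unit normal of `∂Ω` at `p` that points out of `Ω`: the normalized gradient of a defining
function (any two defining functions give the same vector). -/
def outwardNormal (Ω : Set Space) (p : Space) : Space :=
  if h : ∃ r, IsDefiningFunction Ω p r then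
    (‖gradient h.choose p‖)⁻¹ • gradient h.choose p
  else 0

/-- The area measure `ν` on surfaces: two-dimensional Hausdorff measure, normalized so that it is
Lebesgue measure on planes. -/
abbrev area : Measure Space := Measure.euclideanHausdorffMeasure 2

/-- `n_b`: the unit normal of `Σ_b = ∂B` that points away from the body, into the fluid. -/
def bodyNormal (B : Set Space) (l : Space) : Space := -outwardNormal Bᶜ l

/-- `n_f`: the unit normal of `Σ_f = ∂W` that points away from the fluid. -/
def surfaceNormal (W : Set Space) (l : Space) : Space := outwardNormal W l

/-! ### The configuration -/

/-- A rigid body `B` completely submerged beneath a free surface `Σ_f`, in a frame fixed in the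
body. `W` is the open region below the free surface (occupied by the fluid and the body together),
`Σ_f = ∂W`, the fluid domain is `W \ B`, `Σ_b = ∂B`, and there is no bottom. The unit vector `k` is
the upward vertical and `η₀` is the elevation of the undisturbed surface. -/
structure IsConfiguration (W B : Set Space) (k : Space) (η₀ : ℝ) : Prop where
  norm_k : ‖k‖ = 1
  body_nonempty : B.Nonempty
  body_compact : IsCompact B
  body_smooth : IsSmoothDomain Bᶜ
  /-- the origin of the frame is the center of mass of the body, which has uniform density -/
  body_center : ∫ l in B, l = 0
  body_submerged : B ⊆ W
  surface_smooth : IsSmoothDomain W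
  /-- the fluid is infinitely deep -/
  deep : ∃ c : ℝ, ∀ l : Space, ⟪k, l⟫ < c → l ∈ W
  /-- the fluid lies below some horizontal plane -/
  bounded_above : ∃ c : ℝ, ∀ l ∈ W, ⟪k, l⟫ < c
  /-- far from the body the free surface approaches its undisturbed elevation -/
  far_flat : Tendsto (fun l : Space => ⟪k, l⟫) (cocompact Space ⊓ 𝓟 (frontier W)) (𝓝 η₀)
  fluid_connected : IsConnected (W \ B)

/-! ### The boundary-value problems -/

/-- `Φ` solves the Kirchhoff problem outside the body `B` moving with velocities `u = (V, Ω)`: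
`Φ` is smooth up to the boundary and harmonic outside `B`, `∇Φ · n_b = (V + Ω × l) · n_b` on
`Σ_b`, and `Φ → 0` at infinity. -/
structure IsKirchhoffPotential (B : Set Space) (u : Idx → ℝ) (Φ : Space → ℝ) : Prop where
  smooth : ContDiffOn ℝ ∞ Φ (closure Bᶜ)
  harmonic : InnerProductSpace.HarmonicOnNhd Φ Bᶜ
  neumann : ∀ l ∈ frontier B,
    fderivWithin ℝ Φ (closure Bᶜ) l (bodyNormal B l) = ⟪rigidVelocity u l, bodyNormal B l⟫
  decay : Tendsto Φ (cocompact Space) (𝓝 0)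

/-- Dirichlet data on the free surface: smooth functions on `Σ_f` that tend to `0` at infinity.
Only the values on `Σ_f` matter. -/
def IsSurfaceData (W : Set Space) (φ : Space → ℝ) : Prop :=
  ContDiffOn ℝ ∞ φ (frontier W) ∧ Tendsto φ (cocompact Space ⊓ 𝓟 (frontier W)) (𝓝 0)

/-- `Φ` solves the mixed Dirichlet–Neumann problem in the fluid domain `W \ B`, for the Dirichlet
data `φ` on `Σ_f` and the body velocities `u = (V, Ω)`. -/
structure IsMixedSolution (W B : Set Space) (u : Idx → ℝ) (φ Φ : Space → ℝ) : Prop where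
  smooth : ContDiffOn ℝ ∞ Φ (closure (W \ B))
  harmonic : InnerProductSpace.HarmonicOnNhd Φ (W \ B)
  dirichlet : ∀ l ∈ frontier W, Φ l = φ l
  neumann : ∀ l ∈ frontier B,
    fderivWithin ℝ Φ (closure (W \ B)) l (bodyNormal B l) = ⟪rigidVelocity u l, bodyNormal B l⟫
  decay : Tendsto Φ (cocompact Space ⊓ 𝓟 (closure (W \ B))) (𝓝 0)

/-- Existence and uniqueness of solutions of the mixed Dirichlet–Neumann problem. -/
def MixedProblemWellPosed (W B : Set Space) : Prop :=
  ∀ (u : Idx → ℝ) (φ : Space → ℝ), IsSurfaceData W φ →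
    ∃ Φ, IsMixedSolution W B u φ Φ ∧
      ∀ Φ', IsMixedSolution W B u φ Φ' → EqOn Φ' Φ (closure (W \ B))

/-! ### The linear maps -/

/-- `L_K`: the Kirchhoff potential `∑ᵢ uᵢ Ψᵢ` of the velocities `u`, where the `Ψᵢ` are the six unit
potentials `(Ψ_x, Ψ_y, Ψ_z, ζ_x, ζ_y, ζ_z)`. -/
def LK (Ψ : Idx → Space → ℝ) (u : Idx → ℝ) : Space → ℝ :=
  fun l => ∑ i, u i * Ψ i l

open Classical in
/-- `L_S`: the solution, for a stationary body, of the mixed problem with Dirichlet data `φ`. -/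
def LS (W B : Set Space) (φ : Space → ℝ) : Space → ℝ :=
  if h : ∃ Φ, IsMixedSolution W B 0 φ Φ then h.choose else 0

/-- `I_B Φ = (-∫ Φ n_b, -∫ l × Φ n_b)`, integrals over `Σ_b`. -/
def IB (B : Set Space) (Φ : Space → ℝ) : Idx → ℝ :=
  fun i => -∫ l in frontier B, Φ l * wrench (bodyNormal B l) l i ∂area

/-- `I_F φ = (∫ φ n_f, ∫ l × φ n_f)`, integrals over `Σ_f`. -/
def IF (W : Set Space) (φ : Space → ℝ) : Idx → ℝ :=
  fun i => ∫ l in frontier W, φ l * wrench (surfaceNormal W l) l i ∂area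

/-- The integrals that define `I_F φ` converge. -/
def HasIF (W : Set Space) (φ : Space → ℝ) : Prop :=
  ∀ i, IntegrableOn (fun l => φ l * wrench (surfaceNormal W l) l i) (frontier W) area

/-! ### The matrices -/

/-- The body mass tensor for unit density: volume of `B`, and inertia tensor of `B` about the
origin. -/
def massB (B : Set Space) : Matrix Idx Idx ℝ :=
  Matrix.fromBlocks ((volume B).toReal • (1 : Matrix (Fin 3) (Fin 3) ℝ)) 0 0
    (Matrix.of fun i j => ∫ l in B, ((if i = j then ‖l‖ ^ 2 else 0) - l i * l j))

/-- The added-mass matrix `M_a`, the matrix of `I_B ∘ L_{K,b}`. -/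
def massA (B : Set Space) (Ψ : Idx → Space → ℝ) : Matrix Idx Idx ℝ :=
  Matrix.of fun i j => IB B (LK Ψ (Pi.single j 1)) i

/-- The coupling matrix `M_c`, the matrix of `-I_B ∘ L_{S,b} ∘ L_{K,f}`. -/
def massC (W B : Set Space) (Ψ : Idx → Space → ℝ) : Matrix Idx Idx ℝ :=
  Matrix.of fun i j => -IB B (LS W B (LK Ψ (Pi.single j 1))) i

/-! ### Variations -/

/-- The body velocities can be varied by some `δu = (δV, δΩ)` so that, with the variation `δΦ` of
the fluid potential induced through the mixed problem by `δu` and by the variation `δφ` of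
the Dirichlet data on `Σ_f`, the momenta `(𝔏, 𝔄) = ρ M_b (V, Ω) + ρ P_f` vary by exactly `δp`. Here
`P_f = (-∫_{Σ_b} Φ n_b + ∫_{Σ_f} Φ n_f, -∫_{Σ_b} l × Φ n_b + ∫_{Σ_f} l × Φ n_f)`. -/
def VariationPossible (W B : Set Space) (ρ : ℝ) (δφ : Space → ℝ) (δp : Idx → ℝ) : Prop :=
  ∃ (δu : Idx → ℝ) (δΦ : Space → ℝ), IsMixedSolution W B δu δφ δΦ ∧
    δp = ρ • (massB B).mulVec δu + ρ • (IB B δΦ + IF W δΦ)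

/-- Each of the variables `(Σ_f, φ_f, 𝔏, 𝔄)` can be varied arbitrarily with the others kept fixed,
at a state whose fluid potential is `Φ`. A normal variation `δs n_f` of `Σ_f` with `δφ_f = 0`
changes the Dirichlet data on `Σ_f` by `-∇Φ · (δs n_f)`. -/
structure IndependentVariationsPossible (W B : Set Space) (ρ : ℝ) (Φ : Space → ℝ) : Prop where
  linear : ∀ δL : Fin 3 → ℝ, VariationPossible W B ρ 0 (Sum.elim δL 0)
  angular : ∀ δA : Fin 3 → ℝ, VariationPossible W B ρ 0 (Sum.elim 0 δA)
  potential : ∀ δφ : Space → ℝ, IsSurfaceData W δφ → HasIF W δφ →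
    VariationPossible W B ρ δφ 0
  surface : ∀ δs δφ : Space → ℝ, ContDiffOn ℝ ∞ δs (frontier W) →
    (∀ l ∈ frontier W,
      δφ l = -fderivWithin ℝ Φ (closure (W \ B)) l (δs l • surfaceNormal W l)) →
    IsSurfaceData W δφ → HasIF W δφ →
    VariationPossible W B ρ δφ 0

end FreeSurfaceBody

end

open FreeSurfaceBody

/-!
Everything rests on one symmetry: if `Φ₁`, `Φ₂` are harmonic in a smooth domain, smooth up to its
boundary, tend to `0` at infinity, and vanish on the boundary outside a compact set, then
`∫ Φ₁ ∂ₙΦ₂ = ∫ Φ₂ ∂ₙΦ₁` (`IsSmoothDomain.integral_mul_normalDeriv_comm`).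

Applied to the Kirchhoff potentials `Ψⱼ` outside the body it says that `M_a` is symmetric. The
differences `Gⱼ = Ψⱼ - L_S Ψⱼ` solve the mixed problem with body velocities `eⱼ` and zero
potential on the free surface, and `M_a + M_c` is the matrix of `eⱼ ↦ I_B Gⱼ`; applied to the `Gⱼ`
in the fluid domain, the same symmetry says that `M_a + M_c` is symmetric, hence so is `M_c`
(`massA_add_massC_isSymm`). By uniqueness, a potential that vanishes on the free surface is the
combination of the `Gⱼ` with the velocities as coefficients, so it contributes `ρ M u` to the
momenta (`VariationPossible.exists_mulVec_eq`); varying the momenta alone therefore requires `M` to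
be onto, and if `M` is invertible the velocities can compensate for any change of the surface data
(`variationPossible_of_isUnit`).

*Green's identity in an unbounded domain.* No rate of decay is available, but none is needed. With
`Q = Φ₁² + Φ₂²`, a smooth cutoff `c` that vanishes for `Q ≤ 1/k` and is `1` for `Q ≥ 2/k` has
compact support. Testing with `c Φ₁`, `c Φ₂` bounds the energy `∫ |∇Φ₁|² + |∇Φ₂|²` over `{Q > 0}`
uniformly in `k` (`integrableOn_energyDensity`), and the error in the second identity is bounded by
the energy in the layer `{1/k ≤ Q ≤ 2/k}`, which tends to `0`.

*The divergence theorem* (`IsSmoothDomain.setIntegral_fderivWithin`) is proved for the Hausdorff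
area measure by localizing. Near a boundary point, take `n` normal to the boundary there and a
defining function `r`. The part of a field tangent to the level sets of `r` contributes nothing
(`IsFlatPatch.setIntegral_fderivWithin_eq`), which leaves a field in the direction `n`, for which
the fundamental theorem of calculus on the lines parallel to `n` gives an integral over the plane
orthogonal to `n` (`IsFlatPatch.setIntegral_fderivWithin_normal`). On a small patch the projection to
that plane is nearly an isometry of the boundary, so area and planar measure agree up to a factor
`1 + O(δ)` (`IsFlatPatch.volume_le_map_shadow`, `IsFlatPatch.map_shadow_le`). A partition of unity
gives the theorem with relative error `ε` for every `ε > 0`; this replaces an exact area formula.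
-/

namespace FreeSurfaceBody

/-! ### Flat patches of a smooth boundary -/

/-- On the open set `V`, the set `Ω` is `{r < 0}` and `r` is, up to relative slope error `δ`, the
linear function with gradient `m • n`, where `n` is a unit vector. -/
structure IsFlatPatch (Ω V : Set Space) (r : Space → ℝ) (n : Space) (m δ : ℝ) : Prop where
  isOpen : IsOpen V
  norm_n : ‖n‖ = 1
  m_pos : 0 < m
  smooth : ContDiff ℝ ∞ r
  mem_iff : ∀ x ∈ V, (x ∈ Ω ↔ r x < 0)
  grad_close : ∀ x ∈ V, ‖gradient r x - m • n‖ ≤ δ * m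
  sub_close : ∀ x ∈ V, ∀ y ∈ V, |r x - r y - m * ⟪n, x - y⟫| ≤ δ * m * ‖x - y‖

theorem IsSmoothDomain.exists_isFlatPatch {Ω : Set Space} (hΩ : IsSmoothDomain Ω) {p : Space}
    (hp : p ∈ frontier Ω) {δ : ℝ} (hδ : 0 < δ) :
    ∃ r n m R, 0 < R ∧ r p = 0 ∧ IsFlatPatch Ω (Metric.ball p R) r n m δ := by
  obtain ⟨r, hr, hrp, hgp, hmem⟩ := hΩ.2 p hp
  have hm : 0 < ‖gradient r p‖ := norm_pos_iff.2 hgp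
  have hcont : Continuous (gradient r) := by
    have : Continuous (fderiv ℝ r) := hr.continuous_fderiv (by simp)
    exact (InnerProductSpace.toDual ℝ Space).symm.continuous.comp this
  have hnear : ∀ᶠ x in 𝓝 p, ‖gradient r x - gradient r p‖ < δ * ‖gradient r p‖ := by
    have : Tendsto (fun x => ‖gradient r x - gradient r p‖) (𝓝 p) (𝓝 0) := by
      have h := ((hcont.tendsto p).sub_const (gradient r p)).norm
      simpa using h
    exact this.eventually (gt_mem_nhds (by positivity))
  obtain ⟨R, hR, hball⟩ := Metric.eventually_nhds_iff_ball.1 (hmem.and hnear)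
  have hmn : ‖gradient r p‖ • (‖gradient r p‖⁻¹ • gradient r p) = gradient r p := by
    rw [smul_smul, mul_inv_cancel₀ hm.ne', one_smul]
  refine ⟨r, ‖gradient r p‖⁻¹ • gradient r p, ‖gradient r p‖, R, hR, hrp,
    Metric.isOpen_ball, ?_, hm, hr, fun x hx => (hball x hx).1, fun x hx => ?_, ?_⟩
  · rw [norm_smul, norm_inv, norm_norm, inv_mul_cancel₀ hm.ne']
  · rw [hmn]; exact (hball x hx).2.le
  · intro x hx y hy
    have := (convex_ball p R).norm_image_sub_le_of_norm_fderiv_le' (𝕜 := ℝ) (f := r)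
      (φ := fderiv ℝ r p) (C := δ * ‖gradient r p‖)
      (fun z _ => (hr.differentiable (by simp)).differentiableAt)
      (fun z hz => by
        rw [← toDual_gradient, ← toDual_gradient, ← map_sub, LinearIsometryEquiv.norm_map]
        exact (hball z hz).2.le) hy hx
    rw [← inner_gradient_left, Real.norm_eq_abs] at this
    have h2 : ‖gradient r p‖ * ⟪‖gradient r p‖⁻¹ • gradient r p, x - y⟫
        = ⟪gradient r p, x - y⟫ := by
      rw [← real_inner_smul_left, hmn]
    rwa [h2]

namespace IsFlatPatch

variable {Ω V : Set Space} {r : Space → ℝ} {n : Space} {m δ : ℝ}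

/-- The derivative of `r` in the direction `n` is at least `(1 - δ) m`. -/
theorem le_inner_gradient (h : IsFlatPatch Ω V r n m δ) {x : Space} (hx : x ∈ V) :
    (1 - δ) * m ≤ ⟪gradient r x, n⟫ := by
  have h1 := abs_real_inner_le_norm (gradient r x - m • n) n
  rw [h.norm_n, mul_one, inner_sub_left, real_inner_smul_left, real_inner_self_eq_norm_sq,
    h.norm_n] at h1
  have h2 := h1.trans (h.grad_close x hx)
  have := (abs_le.1 h2).1
  linarith

theorem norm_gradient_le (h : IsFlatPatch Ω V r n m δ) {x : Space} (hx : x ∈ V) :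
    ‖gradient r x‖ ≤ (1 + δ) * m := by
  have h1 := norm_sub_norm_le (gradient r x) (m • n)
  rw [norm_smul, h.norm_n, mul_one, Real.norm_of_nonneg h.m_pos.le] at h1
  linarith [h.grad_close x hx]

theorem gradient_ne_zero (h : IsFlatPatch Ω V r n m δ) (hδ : δ < 1) {x : Space} (hx : x ∈ V) :
    gradient r x ≠ 0 := by
  intro h0
  have := h.le_inner_gradient hx
  rw [h0, inner_zero_left] at this
  nlinarith [h.m_pos]

/-- Along lines in the direction `n` the function `r` grows with slope at least `(1 - δ) m`. -/
theorem slope_le (h : IsFlatPatch Ω V r n m δ) {x : Space} {s t : ℝ} (hst : s ≤ t)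
    (hs : x + s • n ∈ V) (ht : x + t • n ∈ V) :
    (1 - δ) * m * (t - s) ≤ r (x + t • n) - r (x + s • n) := by
  have h1 := h.sub_close _ ht _ hs
  have h2 : x + t • n - (x + s • n) = (t - s) • n := by rw [sub_smul]; abel
  rw [h2, real_inner_smul_right, real_inner_self_eq_norm_sq, norm_smul, h.norm_n,
    Real.norm_of_nonneg (by linarith)] at h1
  have := (abs_le.1 h1).1
  linarith

theorem mem_frontier_iff (h : IsFlatPatch Ω V r n m δ) (hΩ : IsOpen Ω) (hδ : δ < 1) {x : Space}
    (hx : x ∈ V) : x ∈ frontier Ω ↔ r x = 0 := by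
  rw [hΩ.frontier_eq, Set.mem_sdiff, h.mem_iff x hx, not_lt]
  constructor
  · rintro ⟨hcl, h0⟩
    refine le_antisymm ?_ h0
    have hx' : x ∈ closure (V ∩ Ω) := h.isOpen.inter_closure ⟨hx, hcl⟩
    exact closure_minimal (fun y hy => ((h.mem_iff y hy.1).1 hy.2).le)
      (isClosed_le h.smooth.continuous continuous_const) hx'
  · intro h0
    refine ⟨?_, h0.ge⟩
    have hlim : Tendsto (fun t : ℝ => x + t • n) (𝓝[<] 0) (𝓝 x) := by
      have : Continuous fun t : ℝ => x + t • n := by fun_prop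
      have h1 := this.tendsto 0
      simp only [zero_smul, add_zero] at h1
      exact h1.mono_left nhdsWithin_le_nhds
    refine mem_closure_of_tendsto hlim ?_
    filter_upwards [hlim.eventually (h.isOpen.mem_nhds hx), self_mem_nhdsWithin] with t ht ht0
    rw [h.mem_iff _ ht]
    have := h.slope_le (x := x) (s := t) (t := 0) (le_of_lt ht0) ht (by simpa using hx)
    simp only [zero_smul, add_zero, h0] at this
    have h3 : t < 0 := ht0
    nlinarith [mul_pos (sub_pos.2 hδ) h.m_pos]

theorem mem_closure_iff (h : IsFlatPatch Ω V r n m δ) (hΩ : IsOpen Ω) (hδ : δ < 1) {x : Space}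
    (hx : x ∈ V) : x ∈ closure Ω ↔ r x ≤ 0 := by
  rw [closure_eq_self_union_frontier, mem_union, h.mem_iff x hx, h.mem_frontier_iff hΩ hδ hx,
    le_iff_lt_or_eq]

theorem isDefiningFunction (h : IsFlatPatch Ω V r n m δ) (hΩ : IsOpen Ω) (hδ : δ < 1) {x : Space}
    (hx : x ∈ V) (hxf : x ∈ frontier Ω) : IsDefiningFunction Ω x r :=
  ⟨h.smooth, (h.mem_frontier_iff hΩ hδ hx).1 hxf, h.gradient_ne_zero hδ hx,
    eventually_of_mem (h.isOpen.mem_nhds hx) h.mem_iff⟩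

end IsFlatPatch

/-! ### The unit normal -/

/-- Any two defining functions have positively proportional gradients. -/
theorem IsDefiningFunction.normalized_gradient_eq {Ω : Set Space} {p : Space} {r₁ r₂ : Space → ℝ}
    (h₁ : IsDefiningFunction Ω p r₁) (h₂ : IsDefiningFunction Ω p r₂) :
    ‖gradient r₁ p‖⁻¹ • gradient r₁ p = ‖gradient r₂ p‖⁻¹ • gradient r₂ p := by
  obtain ⟨hr₁, h₁p, hg₁, hm₁⟩ := h₁
  obtain ⟨hr₂, h₂p, hg₂, hm₂⟩ := h₂
  set a := gradient r₁ p with ha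
  set b := gradient r₂ p with hb
  have key : ∀ v, ⟪a, v⟫ < 0 → ⟪b, v⟫ ≤ 0 := by
    intro v hv
    have hline : ∀ (r : Space → ℝ), ContDiff ℝ ∞ r →
        HasDerivAt (fun t : ℝ => r (p + t • v)) ⟪gradient r p, v⟫ 0 := by
      intro r hr
      have h1 : HasFDerivAt r (fderiv ℝ r p) (p + (0 : ℝ) • v) := by
        simpa using (hr.differentiable (by simp) p).hasFDerivAt
      have h2 : HasDerivAt (fun t : ℝ => p + t • v) v 0 := by
        simpa using ((hasDerivAt_id (0 : ℝ)).smul_const v).const_add p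
      rw [inner_gradient_left]
      exact h1.comp_hasDerivAt 0 h2
    have hlim : Tendsto (fun t : ℝ => p + t • v) (𝓝[>] 0) (𝓝 p) := by
      have : Continuous fun t : ℝ => p + t • v := by fun_prop
      have h1 := this.tendsto 0
      simp only [zero_smul, add_zero] at h1
      exact h1.mono_left nhdsWithin_le_nhds
    have hs₁ := (hasDerivAt_iff_tendsto_slope.1 (hline r₁ hr₁)).mono_left
      (nhdsWithin_mono 0 (s := Ioi 0) (fun t ht => ne_of_gt ht))
    have hs₂ := (hasDerivAt_iff_tendsto_slope.1 (hline r₂ hr₂)).mono_left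
      (nhdsWithin_mono 0 (s := Ioi 0) (fun t ht => ne_of_gt ht))
    refine le_of_tendsto hs₂ ?_
    filter_upwards [hs₁.eventually (gt_mem_nhds hv), hlim.eventually hm₁, hlim.eventually hm₂,
      self_mem_nhdsWithin] with t ht e₁ e₂ ht0
    have ht0 : 0 < t := ht0
    have hlt : r₁ (p + t • v) < 0 := by
      simp only [slope_def_field, zero_smul, add_zero, h₁p, sub_zero] at ht
      by_contra hcon
      exact absurd ht (not_lt.2 (div_nonneg (not_lt.1 hcon) ht0.le))
    have hlt₂ : r₂ (p + t • v) < 0 := e₂.1 (e₁.2 hlt)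
    simp only [slope_def_field, zero_smul, add_zero, h₂p, sub_zero]
    exact div_nonpos_of_nonpos_of_nonneg hlt₂.le ht0.le
  have haa : 0 < ⟪a, a⟫ := real_inner_self_pos.2 hg₁
  -- vectors orthogonal to `a` are orthogonal to `b`: perturb them by a small multiple of `-a`
  have orth : ∀ u, ⟪a, u⟫ = 0 → ⟪b, u⟫ ≤ 0 := by
    intro u hu
    have hlim : Tendsto (fun η : ℝ => ⟪b, u - η • a⟫) (𝓝[>] 0) (𝓝 ⟪b, u⟫) := by
      have : Continuous fun η : ℝ => ⟪b, u - η • a⟫ := by fun_prop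
      have h1 := this.tendsto 0
      simp only [zero_smul, sub_zero] at h1
      exact h1.mono_left nhdsWithin_le_nhds
    refine le_of_tendsto hlim ?_
    filter_upwards [self_mem_nhdsWithin] with η hη
    have hη : 0 < η := hη
    apply key
    rw [inner_sub_right, hu, real_inner_smul_right]
    nlinarith
  set c := ⟪b, a⟫ / ⟪a, a⟫ with hc
  have hu0 : b - c • a = 0 := by
    have h1 : ⟪a, b - c • a⟫ = 0 := by
      rw [inner_sub_right, real_inner_smul_right, hc, div_mul_cancel₀ _ haa.ne',
        real_inner_comm, sub_self]
    have h2 := orth _ h1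
    have h3 : ⟪b - c • a, b - c • a⟫ = ⟪b, b - c • a⟫ := by
      rw [inner_sub_left, real_inner_smul_left, h1, mul_zero, sub_zero]
    exact real_inner_self_nonpos.1 (h3 ▸ h2)
  have hbc : b = c • a := sub_eq_zero.1 hu0
  have hc0 : 0 ≤ c := by
    have := key (-a) (by rw [inner_neg_right]; linarith)
    rw [inner_neg_right] at this
    exact div_nonneg (by linarith) haa.le
  have hcpos : 0 < c := lt_of_le_of_ne hc0 (fun h => hg₂ (by rw [hbc, ← h, zero_smul]))
  rw [hbc, norm_smul, Real.norm_of_nonneg hc0, smul_smul, mul_inv, mul_right_comm,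
    inv_mul_cancel₀ hcpos.ne', one_mul]

theorem IsDefiningFunction.outwardNormal_eq {Ω : Set Space} {p : Space} {r : Space → ℝ}
    (h : IsDefiningFunction Ω p r) :
    outwardNormal Ω p = ‖gradient r p‖⁻¹ • gradient r p := by
  have hex : ∃ r, IsDefiningFunction Ω p r := ⟨r, h⟩
  rw [outwardNormal, dif_pos hex]
  exact hex.choose_spec.normalized_gradient_eq h

/-- The unit normal depends only on the germ of the domain. -/
theorem outwardNormal_congr {Ω Ω' : Set Space} {p : Space} (h : ∀ᶠ x in 𝓝 p, (x ∈ Ω ↔ x ∈ Ω')) :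
    outwardNormal Ω p = outwardNormal Ω' p := by
  have : IsDefiningFunction Ω p = IsDefiningFunction Ω' p := by
    funext r
    refine propext ⟨fun ⟨a, b, c, d⟩ => ⟨a, b, c, ?_⟩, fun ⟨a, b, c, d⟩ => ⟨a, b, c, ?_⟩⟩
    · filter_upwards [h, d] with x h1 h2 using h1.symm.trans h2
    · filter_upwards [h, d] with x h1 h2 using h1.trans h2
  unfold outwardNormal
  rw [this]

theorem continuous_gradient {r : Space → ℝ} (hr : ContDiff ℝ ∞ r) : Continuous (gradient r) :=
  (InnerProductSpace.toDual ℝ Space).symm.continuous.comp (hr.continuous_fderiv (by simp))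

theorem IsSmoothDomain.continuousOn_outwardNormal {Ω : Set Space} (hΩ : IsSmoothDomain Ω) :
    ContinuousOn (outwardNormal Ω) (frontier Ω) := by
  intro p hp
  obtain ⟨r, n, m, R, hR, -, hf⟩ := hΩ.exists_isFlatPatch hp one_half_pos
  have hpV := Metric.mem_ball_self (x := p) hR
  have hg := continuous_gradient hf.smooth
  have hcont : ContinuousAt (fun x => ‖gradient r x‖⁻¹ • gradient r x) p :=
    (hg.norm.continuousAt.inv₀ (norm_ne_zero_iff.2
      (hf.gradient_ne_zero (by norm_num) hpV))).smul hg.continuousAt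
  refine hcont.continuousWithinAt.congr_of_eventuallyEq ?_
    (hf.isDefiningFunction hΩ.1 (by norm_num) hpV hp).outwardNormal_eq
  filter_upwards [self_mem_nhdsWithin, mem_nhdsWithin_of_mem_nhds (hf.isOpen.mem_nhds hpV)]
    with x hx hxV
  exact (hf.isDefiningFunction hΩ.1 (by norm_num) hxV hx).outwardNormal_eq

/-- Derivatives within the closure of a smooth domain are unique. -/
theorem IsSmoothDomain.uniqueDiffOn_closure {Ω : Set Space} (hΩ : IsSmoothDomain Ω) :
    UniqueDiffOn ℝ (closure Ω) := by
  intro p hp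
  by_cases hpΩ : p ∈ Ω
  · exact (hΩ.1.uniqueDiffWithinAt hpΩ).mono subset_closure
  have hpf : p ∈ frontier Ω := by rw [hΩ.1.frontier_eq]; exact ⟨hp, hpΩ⟩
  obtain ⟨r, n, m, R, hR, hrp, hf⟩ := hΩ.exists_isFlatPatch hpf one_half_pos
  refine UniqueDiffWithinAt.mono ?_ subset_closure
  refine ⟨?_, hp⟩
  -- the tangent cone spans: up to scaling it contains an open cone around `-n`
  set C : Set Space := {v | ⟪n, v⟫ + 1 / 2 * ‖v‖ < 0}
  have hCopen : IsOpen C := isOpen_lt (by fun_prop) continuous_const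
  have hCne : (-n) ∈ C := by
    simp only [C, mem_ofPred_eq, inner_neg_right, real_inner_self_eq_norm_sq, norm_neg, hf.norm_n]
    norm_num
  have hsub : C ⊆ Submodule.span ℝ (tangentConeAt ℝ Ω p) := by
    intro v hv
    have hv0 : v ≠ 0 := by
      rintro rfl
      simp [C] at hv
    have hvn : 0 < ‖v‖ := norm_pos_iff.2 hv0
    set c := R / ‖v‖
    have hc : 0 < c := div_pos hR hvn
    have hseg : openSegment ℝ p (p + c • v) ⊆ Ω := by
      rw [openSegment_eq_image']
      rintro _ ⟨t, ⟨ht0, ht1⟩, rfl⟩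
      simp only [add_sub_cancel_left, smul_smul]
      have htc : 0 < t * c := mul_pos ht0 hc
      have hmem : p + (t * c) • v ∈ Metric.ball p R := by
        rw [mem_ball_iff_norm, add_sub_cancel_left, norm_smul, Real.norm_of_nonneg htc.le]
        simp only [c]
        rw [mul_assoc, div_mul_cancel₀ _ hvn.ne']
        nlinarith
      rw [hf.mem_iff _ hmem]
      have h1 := hf.sub_close _ hmem _ (Metric.mem_ball_self hR)
      rw [add_sub_cancel_left, hrp, real_inner_smul_right, norm_smul,
        Real.norm_of_nonneg htc.le] at h1
      have h2 := (abs_le.1 h1).2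
      have h3 : ⟪n, v⟫ + 1 / 2 * ‖v‖ < 0 := hv
      have h4 := mul_pos hf.m_pos htc
      nlinarith
    have hmem := Submodule.subset_span (R := ℝ) (mem_tangentConeAt_of_openSegment_subset hseg)
    rw [add_sub_cancel_left] at hmem
    have := Submodule.smul_mem _ c⁻¹ hmem
    rwa [smul_smul, inv_mul_cancel₀ hc.ne', one_smul] at this
  have htop : Submodule.span ℝ (tangentConeAt ℝ Ω p) = ⊤ :=
    Submodule.eq_top_of_nonempty_interior' _
      ⟨-n, interior_maximal hsub hCopen hCne⟩
  rw [htop]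
  exact dense_univ

/-! ### Functions on a closed domain with compact support -/

/-- A continuous function on `closure Ω` that vanishes off a compact set is integrable on any
measurable part of `closure Ω` whose intersection with the compact set has finite measure. -/
theorem integrableOn_of_zero_off_compact {Ω S K : Set Space} {μ : Measure Space} {f : Space → ℝ}
    (hf : ContinuousOn f (closure Ω)) (hS : MeasurableSet S) (hSΩ : S ⊆ closure Ω)
    (hK : IsCompact K) (hμ : μ (S ∩ K) < ⊤) (h0 : ∀ x ∈ closure Ω \ K, f x = 0) :
    IntegrableOn f S μ := by
  have hK' : IsCompact (closure Ω ∩ K) := hK.inter_left isClosed_closure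
  obtain ⟨C, hC⟩ := hK'.exists_bound_of_continuousOn (hf.mono inter_subset_left)
  have hSK : MeasurableSet (S ∩ K) := hS.inter hK.measurableSet
  refine IntegrableOn.of_forall_sdiff_eq_zero (s := S ∩ K) ?_ hS ?_
  · refine IntegrableOn.of_bound hμ ?_ C ?_
    · exact (hf.mono (inter_subset_left.trans hSΩ)).aestronglyMeasurable hSK
    · exact (ae_restrict_iff' hSK).2 (ae_of_all _ fun x hx => hC x ⟨hSΩ hx.1, hx.2⟩)
  · rintro x ⟨hx, hx'⟩
    exact h0 x ⟨hSΩ hx, fun h => hx' ⟨hx, h⟩⟩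

theorem integrableOn_of_zero_off_compact_volume {Ω K : Set Space} (hΩ : IsOpen Ω)
    {f : Space → ℝ} (hf : ContinuousOn f (closure Ω)) (hK : IsCompact K)
    (h0 : ∀ x ∈ closure Ω \ K, f x = 0) : IntegrableOn f Ω :=
  integrableOn_of_zero_off_compact hf hΩ.measurableSet subset_closure hK
    ((measure_mono inter_subset_right).trans_lt hK.measure_lt_top) h0

theorem fderivWithin_closure_eq {Ω : Set Space} (hΩ : IsOpen Ω) {F : Type*} [NormedAddCommGroup F]
    [NormedSpace ℝ F] (f : Space → F) {x : Space} (hx : x ∈ Ω) :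
    fderivWithin ℝ f (closure Ω) x = fderiv ℝ f x :=
  fderivWithin_of_mem_nhds (mem_of_superset (hΩ.mem_nhds hx) subset_closure)

theorem eventuallyEq_zero_off_compact {Ω K : Set Space} (hK : IsCompact K) {f : Space → ℝ}
    (h0 : ∀ x ∈ closure Ω \ K, f x = 0) {x : Space} (hx : x ∉ K) :
    f =ᶠ[𝓝[closure Ω] x] fun _ => 0 := by
  filter_upwards [self_mem_nhdsWithin,
    mem_nhdsWithin_of_mem_nhds (hK.isClosed.isOpen_compl.mem_nhds hx)] with y hy hyK
  exact h0 y ⟨hy, hyK⟩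

theorem fderivWithin_zero_off_compact {Ω K : Set Space} (hK : IsCompact K) {f : Space → ℝ}
    (h0 : ∀ x ∈ closure Ω \ K, f x = 0) {x : Space} (hx : x ∈ closure Ω \ K) :
    fderivWithin ℝ f (closure Ω) x = 0 := by
  rw [(eventuallyEq_zero_off_compact hK h0 hx.2).fderivWithin_eq (h0 x hx)]
  simp

theorem IsSmoothDomain.continuousOn_fderivWithin_apply {Ω : Set Space} (hΩ : IsSmoothDomain Ω)
    {f : Space → ℝ} (hf : ContDiffOn ℝ 1 f (closure Ω)) (e : Space) :
    ContinuousOn (fun x => fderivWithin ℝ f (closure Ω) x e) (closure Ω) :=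
  (hf.continuousOn_fderivWithin hΩ.uniqueDiffOn_closure le_rfl).clm_apply continuousOn_const

theorem IsSmoothDomain.integrableOn_fderivWithin {Ω K : Set Space} (hΩ : IsSmoothDomain Ω)
    {f : Space → ℝ} (hf : ContDiffOn ℝ 1 f (closure Ω)) (hK : IsCompact K)
    (h0 : ∀ x ∈ closure Ω \ K, f x = 0) (e : Space) :
    IntegrableOn (fun x => fderivWithin ℝ f (closure Ω) x e) Ω :=
  integrableOn_of_zero_off_compact_volume hΩ.1 (hΩ.continuousOn_fderivWithin_apply hf e) hK
    fun x hx => by rw [fderivWithin_zero_off_compact hK h0 hx]; rfl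

/-- Multiplication by a function that is smooth only near the support. -/
theorem contDiffOn_mul_of_zero_off_compact {Ω V K : Set Space} (hK : IsCompact K)
    (hV : IsOpen V) (hKV : K ⊆ V) {f w : Space → ℝ} (hf : ContDiffOn ℝ 1 f (closure Ω))
    (h0 : ∀ x ∈ closure Ω \ K, f x = 0) (hw : ContDiffOn ℝ 1 w V) :
    ContDiffOn ℝ 1 (fun x => f x * w x) (closure Ω) := by
  intro x hx
  by_cases hxK : x ∈ K
  · exact (hf x hx).mul ((hw.contDiffAt (hV.mem_nhds (hKV hxK))).contDiffWithinAt)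
  · refine (contDiffWithinAt_const (c := (0 : ℝ))).congr_of_eventuallyEq ?_ ?_
    · filter_upwards [eventuallyEq_zero_off_compact hK h0 hxK] with y hy
      rw [hy, zero_mul]
    · rw [h0 x ⟨hx, hxK⟩, zero_mul]

/-- The integral of a derivative of a function with compact support inside `Ω` vanishes. -/
theorem setIntegral_fderiv_eq_zero {Ω K : Set Space} (hΩ : IsOpen Ω) (hK : IsCompact K)
    (hKΩ : K ⊆ Ω) {u : Space → ℝ} (hu : ContDiffOn ℝ 1 u Ω) (h0 : ∀ x ∈ Ω \ K, u x = 0)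
    (e : Space) : ∫ x in Ω, fderiv ℝ u x e = 0 := by
  set v : Space → ℝ := Ω.indicator u with hv
  have hvK : ∀ x ∉ K, v x = 0 := by
    intro x hx
    by_cases hxΩ : x ∈ Ω
    · rw [hv, indicator_of_mem hxΩ, h0 x ⟨hxΩ, hx⟩]
    · rw [hv, indicator_of_notMem hxΩ]
  have hvsmooth : ContDiff ℝ 1 v := by
    rw [contDiff_iff_contDiffAt]
    intro x
    by_cases hx : x ∈ Ω
    · refine (hu.contDiffAt (hΩ.mem_nhds hx)).congr_of_eventuallyEq ?_
      filter_upwards [hΩ.mem_nhds hx] with y hy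
      rw [hv, indicator_of_mem hy]
    · have hxK : x ∉ K := fun h => hx (hKΩ h)
      refine (contDiffAt_const (c := (0 : ℝ))).congr_of_eventuallyEq ?_
      filter_upwards [hK.isClosed.isOpen_compl.mem_nhds hxK] with y hy using hvK y hy
  have hsupp : HasCompactSupport v := HasCompactSupport.intro hK hvK
  have hd : Continuous fun x => fderiv ℝ v x e :=
    (hvsmooth.continuous_fderiv one_ne_zero).clm_apply continuous_const
  have hdint : Integrable fun x => fderiv ℝ v x e :=
    hd.integrable_of_hasCompactSupport (hsupp.fderiv_apply ℝ e)
  have hvint : Integrable v := hvsmooth.continuous.integrable_of_hasCompactSupport hsupp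
  have hzero : ∫ x, fderiv ℝ v x e = 0 := by
    have := integral_mul_fderiv_eq_neg_fderiv_mul_of_integrable (μ := (volume : Measure Space))
      (f := fun _ : Space => (1 : ℝ)) (g := v) (v := e) (by simp) (by simpa using hdint)
      (by simpa using hvint) (fun x _ => differentiableAt_const _)
      (fun x _ => (hvsmooth.differentiable one_ne_zero) x)
    simpa using this
  rw [← hzero, ← integral_indicator hΩ.measurableSet]
  congr 1
  funext x
  by_cases hx : x ∈ Ω
  · rw [indicator_of_mem hx]
    have : u =ᶠ[𝓝 x] v := by
      filter_upwards [hΩ.mem_nhds hx] with y hy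
      rw [hv, indicator_of_mem hy]
    rw [this.fderiv_eq]
  · rw [indicator_of_notMem hx]
    have hxK : x ∉ K := fun h => hx (hKΩ h)
    have : v =ᶠ[𝓝 x] fun _ => 0 := by
      filter_upwards [hK.isClosed.isOpen_compl.mem_nhds hxK] with y hy using hvK y hy
    rw [this.fderiv_eq]
    simp

/-! ### Derivatives along the level sets integrate to zero -/

namespace IsFlatPatch

variable {Ω V : Set Space} {r : Space → ℝ} {n : Space} {m δ : ℝ}

/-- The slope of the level sets of `r` in the direction `e`, relative to the direction `n`. -/
theorem contDiffOn_slope (h : IsFlatPatch Ω V r n m δ) (hδ : δ < 1) (e : Space) :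
    ContDiffOn ℝ 1 (fun x => fderiv ℝ r x e / fderiv ℝ r x n) V := by
  have hs : ContDiff ℝ 1 (fderiv ℝ r) := h.smooth.fderiv_right (by norm_cast)
  refine ContDiffOn.div (hs.clm_apply contDiff_const).contDiffOn
    (hs.clm_apply contDiff_const).contDiffOn fun x hx => ?_
  rw [← inner_gradient_left]
  have := h.le_inner_gradient hx
  nlinarith [mul_pos (sub_pos.2 hδ) h.m_pos]

/-- The field `f • e - (f ∂ₑr / ∂ₙr) • n` is tangent to the level sets of `r`, so the integral of
its divergence over `{r < 0}` has no boundary term. -/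
theorem setIntegral_fderivWithin_eq (h : IsFlatPatch Ω V r n m δ) (hδ : δ < 1)
    (hΩ : IsSmoothDomain Ω) {K : Set Space} (hK : IsCompact K) (hKV : K ⊆ V) {f : Space → ℝ}
    (hf : ContDiffOn ℝ 1 f (closure Ω)) (h0 : ∀ x ∈ closure Ω \ K, f x = 0) (e : Space) :
    ∫ x in Ω, fderivWithin ℝ f (closure Ω) x e =
      ∫ x in Ω, fderivWithin ℝ (fun x => f x * (fderiv ℝ r x e / fderiv ℝ r x n))
        (closure Ω) x n := by
  set w : Space → ℝ := fun x => fderiv ℝ r x e / fderiv ℝ r x n with hw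
  have hwV := h.contDiffOn_slope hδ e
  have hfw : ContDiffOn ℝ 1 (fun x => f x * w x) (closure Ω) :=
    contDiffOn_mul_of_zero_off_compact hK h.isOpen hKV hf h0 hwV
  have h0w : ∀ x ∈ closure Ω \ K, f x * w x = 0 := fun x hx => by rw [h0 x hx, zero_mul]
  have hi₁ := hΩ.integrableOn_fderivWithin hf hK h0 e
  have hi₂ := hΩ.integrableOn_fderivWithin hfw hK h0w n
  -- cutoffs that vanish near the boundary
  set ψ : ℕ → Space → ℝ := fun k x => Real.smoothTransition (-(k * r x) - 1) with hψ
  have hψs : ∀ k, ContDiff ℝ 1 (ψ k) := fun k =>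
    Real.smoothTransition.contDiff.comp
      (((contDiff_const.mul (h.smooth.of_le (by norm_cast))).neg).sub contDiff_const)
  set G : Space → ℝ := fun x => fderivWithin ℝ f (closure Ω) x e -
    fderivWithin ℝ (fun x => f x * w x) (closure Ω) x n with hG
  have hGint : IntegrableOn G Ω := hi₁.sub hi₂
  have hzero : ∀ k : ℕ, ∫ x in Ω, ψ k x * G x = 0 := by
    intro k
    set K' : Set Space := closure Ω ∩ (K ∩ {x | (k : ℝ) * r x ≤ -1}) with hK'
    have hK'c : IsCompact K' := (hK.inter_right (isClosed_le
      (continuous_const.mul h.smooth.continuous) continuous_const)).inter_left isClosed_closure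
    have hK'Ω : K' ⊆ Ω := by
      rintro x ⟨-, hxK, hx⟩
      rw [h.mem_iff x (hKV hxK)]
      have hx : (k : ℝ) * r x ≤ -1 := hx
      by_contra hcon
      nlinarith [mul_nonneg (Nat.cast_nonneg (α := ℝ) k) (not_lt.1 hcon)]
    have hz : ∀ g : Space → ℝ, (∀ x ∈ closure Ω \ K, g x = 0) →
        ∀ x ∈ Ω \ K', g x * ψ k x = 0 := by
      rintro g hg x ⟨hx, hx'⟩
      by_cases hxK : x ∈ K
      · have : -1 < (k : ℝ) * r x := by
          by_contra hcon
          exact hx' ⟨subset_closure hx, hxK, not_lt.1 hcon⟩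
        rw [hψ]
        simp only
        rw [Real.smoothTransition.zero_of_nonpos (by linarith), mul_zero]
      · rw [hg x ⟨subset_closure hx, hxK⟩, zero_mul]
    have hs₁ : ContDiffOn ℝ 1 (fun x => f x * ψ k x) Ω :=
      (hf.mono subset_closure).mul (hψs k).contDiffOn
    have hs₂ : ContDiffOn ℝ 1 (fun x => f x * w x * ψ k x) Ω :=
      (hfw.mono subset_closure).mul (hψs k).contDiffOn
    have z₁ := setIntegral_fderiv_eq_zero hΩ.1 hK'c hK'Ω hs₁ (hz f h0) e
    have z₂ := setIntegral_fderiv_eq_zero hΩ.1 hK'c hK'Ω hs₂ (hz (fun x => f x * w x) h0w) n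
    have hcl : ∀ g : Space → ℝ, ContDiffOn ℝ 1 g (closure Ω) → (∀ x ∈ closure Ω \ K, g x = 0) →
        ∀ e', IntegrableOn (fun x => fderiv ℝ (fun y => g y * ψ k y) x e') Ω := by
      intro g hg hg0 e'
      refine (hΩ.integrableOn_fderivWithin (f := fun y => g y * ψ k y)
        (hg.mul (hψs k).contDiffOn) hK
        (fun x hx => by rw [hg0 x hx, zero_mul]) e').congr_fun ?_ hΩ.1.measurableSet
      intro x hx
      simp only
      rw [fderivWithin_closure_eq hΩ.1 _ hx]
    have : ∫ x in Ω, ψ k x * G x = ∫ x in Ω, (fderiv ℝ (fun x => f x * ψ k x) x e -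
        fderiv ℝ (fun x => f x * w x * ψ k x) x n) := by
      refine setIntegral_congr_fun hΩ.1.measurableSet fun x hx => ?_
      have hnx : closure Ω ∈ 𝓝 x := mem_of_superset (hΩ.1.mem_nhds hx) subset_closure
      have d₁ : DifferentiableAt ℝ f x := ((hf.contDiffAt hnx).differentiableAt one_ne_zero)
      have d₂ : DifferentiableAt ℝ (fun x => f x * w x) x :=
        ((hfw.contDiffAt hnx).differentiableAt one_ne_zero)
      have d₃ : DifferentiableAt ℝ (ψ k) x := (hψs k).differentiable one_ne_zero x
      have hrx : DifferentiableAt ℝ r x := h.smooth.differentiable (by simp) x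
      have e₁ : fderiv ℝ (fun x => f x * ψ k x) x e =
          f x * fderiv ℝ (ψ k) x e + ψ k x * fderiv ℝ f x e := by
        rw [fderiv_fun_mul d₁ d₃]; rfl
      have e₂ : fderiv ℝ (fun x => f x * w x * ψ k x) x n =
          f x * w x * fderiv ℝ (ψ k) x n + ψ k x * fderiv ℝ (fun x => f x * w x) x n := by
        rw [fderiv_fun_mul d₂ d₃]; rfl
      simp only [hG]
      rw [e₁, e₂, fderivWithin_closure_eq hΩ.1 _ hx, fderivWithin_closure_eq hΩ.1 _ hx]
      by_cases hxK : x ∈ K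
      · have hψd : ∀ v, fderiv ℝ (ψ k) x v =
            deriv Real.smoothTransition (-(k * r x) - 1) * (-(k * fderiv ℝ r x v)) := by
          intro v
          have hin : HasFDerivAt (fun x => -((k : ℝ) * r x) - 1) (-((k : ℝ) • fderiv ℝ r x)) x :=
            ((hrx.hasFDerivAt.const_mul (k : ℝ)).neg).sub_const 1
          have hst : HasDerivAt Real.smoothTransition
              (deriv Real.smoothTransition (-(k * r x) - 1)) (-((k : ℝ) * r x) - 1) :=
            ((Real.smoothTransition.contDiff (n := 1)).differentiable one_ne_zero _).hasDerivAt
          have := (hst.comp_hasFDerivAt x hin).fderiv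
          have h2 : fderiv ℝ (ψ k) x = _ := this
          rw [h2]
          simp
        have hn0 : fderiv ℝ r x n ≠ 0 := by
          rw [← inner_gradient_left]
          have := h.le_inner_gradient (hKV hxK)
          nlinarith [mul_pos (sub_pos.2 hδ) h.m_pos]
        have hwx : w x * fderiv ℝ r x n = fderiv ℝ r x e := div_mul_cancel₀ _ hn0
        rw [hψd, hψd, ← hwx]
        ring
      · rw [h0 x ⟨subset_closure hx, hxK⟩]
        ring
    rw [this, integral_sub (hcl f hf h0 e) (hcl _ hfw h0w n), z₁, z₂, sub_zero]
  have hlim : Tendsto (fun k : ℕ => ∫ x in Ω, ψ k x * G x) atTop (𝓝 (∫ x in Ω, G x)) := by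
    refine tendsto_integral_of_dominated_convergence (fun x => ‖G x‖) ?_ hGint.norm ?_ ?_
    · exact fun k => (hψs k).continuous.aestronglyMeasurable.mul hGint.aestronglyMeasurable
    · refine fun k => ae_of_all _ fun x => ?_
      rw [norm_mul, Real.norm_of_nonneg (Real.smoothTransition.nonneg _)]
      exact mul_le_of_le_one_left (norm_nonneg _) (Real.smoothTransition.le_one _)
    · refine (ae_restrict_iff' hΩ.1.measurableSet).2 (ae_of_all _ fun x hx => ?_)
      by_cases hxK : x ∈ K
      · have hrx : r x < 0 := (h.mem_iff x (hKV hxK)).1 hx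
        refine tendsto_const_nhds.congr' ?_
        obtain ⟨N, hN⟩ := exists_nat_ge (2 / (-r x))
        filter_upwards [eventually_ge_atTop N] with k hk
        have hk' : 2 / (-r x) ≤ k := hN.trans (by exact_mod_cast hk)
        rw [div_le_iff₀ (by linarith)] at hk'
        simp only [hψ]
        rw [Real.smoothTransition.one_of_one_le (by linarith), one_mul]
      · have : G x = 0 := by
          simp only [hG]
          rw [fderivWithin_zero_off_compact hK h0 ⟨subset_closure hx, hxK⟩,
            fderivWithin_zero_off_compact hK h0w ⟨subset_closure hx, hxK⟩]
          simp
        simp [this]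
  simp only [hzero] at hlim
  have hG0 : ∫ x in Ω, G x = 0 := tendsto_nhds_unique hlim tendsto_const_nhds |>.symm ▸ rfl
  rw [hG, integral_sub hi₁ hi₂] at hG0
  exact sub_eq_zero.1 hG0

end IsFlatPatch

/-! ### Orthogonal coordinates along a unit vector -/

/-- The orthogonal projection onto the plane orthogonal to `n`. -/
noncomputable abbrev shadow (n : Space) : Space →L[ℝ] (ℝ ∙ n)ᗮ :=
  (ℝ ∙ n)ᗮ.orthogonalProjectionOnto

section Coordinates

variable {n : Space}

theorem coe_shadow (hn : ‖n‖ = 1) (x : Space) : (shadow n x : Space) = x - ⟪n, x⟫ • n := by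
  have h1 := Submodule.starProjection_orthogonal_val (K := (ℝ ∙ n)) x
  have h2 := Submodule.starProjection_unit_singleton (𝕜 := ℝ) hn x
  rw [← h2, ← h1]
  rfl

theorem shadow_add_smul (hn : ‖n‖ = 1) (y : (ℝ ∙ n)ᗮ) (t : ℝ) :
    shadow n ((y : Space) + t • n) = y := by
  have h0 : shadow n n = 0 := by
    rw [← Submodule.coe_eq_zero, coe_shadow hn]
    simp [hn]
  rw [map_add, map_smul, h0, smul_zero, add_zero]
  exact Submodule.orthogonalProjectionOnto_mem_subspace_eq_self y

theorem inner_add_smul (hn : ‖n‖ = 1) (y : (ℝ ∙ n)ᗮ) (t : ℝ) :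
    ⟪n, (y : Space) + t • n⟫ = t := by
  rw [inner_add_right, real_inner_smul_right, real_inner_self_eq_norm_sq, hn,
    Submodule.mem_orthogonal_singleton_iff_inner_right.1 y.2]
  simp

theorem shadow_add_inner_smul (hn : ‖n‖ = 1) (x : Space) :
    (shadow n x : Space) + ⟪n, x⟫ • n = x := by
  rw [coe_shadow hn, sub_add_cancel]

theorem norm_le_shadow_add (hn : ‖n‖ = 1) (x : Space) : ‖x‖ ≤ ‖shadow n x‖ + |⟪n, x⟫| := by
  conv_lhs => rw [← shadow_add_inner_smul hn x]
  refine (norm_add_le _ _).trans ?_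
  rw [norm_smul, hn, mul_one, Real.norm_eq_abs, Submodule.coe_norm]

theorem finrank_plane (hn : ‖n‖ = 1) : Module.finrank ℝ (ℝ ∙ n)ᗮ = 2 := by
  have : Fact (Module.finrank ℝ Space = 2 + 1) := ⟨by simp⟩
  exact Submodule.finrank_orthogonal_span_singleton (by rintro rfl; simp at hn)

theorem volume_plane_eq_area (hn : ‖n‖ = 1) :
    (volume : Measure (ℝ ∙ n)ᗮ) = Measure.euclideanHausdorffMeasure 2 := by
  rw [← finrank_plane hn, InnerProductSpace.euclideanHausdorffMeasure_eq_volume]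

theorem measurePreserving_add_smul (hn : ‖n‖ = 1) :
    MeasurePreserving (fun q : (ℝ ∙ n)ᗮ × ℝ => (q.1 : Space) + q.2 • n)
      (volume.prod volume) volume := by
  have h1 : MeasurePreserving (Prod.swap : (ℝ ∙ n)ᗮ × ℝ → ℝ × (ℝ ∙ n)ᗮ)
      (volume.prod volume) (volume.prod volume) := Measure.measurePreserving_swap
  have h2 := (LinearIsometryEquiv.toSpanUnitSingleton (𝕜 := ℝ) n hn).measurePreserving.prod
    (MeasurePreserving.id (volume : Measure (ℝ ∙ n)ᗮ))
  have h3 := ((ℝ ∙ n).measurePreserving_measurableEquivProd (0 : Space)).symm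
  rw [InnerProductSpace.euclideanHausdorffMeasure_eq_volume] at h3
  convert! (h3.comp h2).comp h1 using 1
  funext q
  simp [add_comm]

/-- Fubini's theorem for the planes orthogonal to `n`. -/
theorem integral_eq_integral_plane_integral_line (hn : ‖n‖ = 1) {F : Space → ℝ}
    (hF : Integrable F) : ∫ x, F x = ∫ y : (ℝ ∙ n)ᗮ, ∫ t : ℝ, F ((y : Space) + t • n) := by
  have hT := measurePreserving_add_smul hn
  have hF' : Integrable F (Measure.map (fun q : (ℝ ∙ n)ᗮ × ℝ => (q.1 : Space) + q.2 • n)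
      (volume.prod volume)) := by rwa [hT.map_eq]
  rw [← integral_prod (fun q : (ℝ ∙ n)ᗮ × ℝ => F ((q.1 : Space) + q.2 • n))
    (hT.integrable_comp_of_integrable hF), ← integral_map hT.measurable.aemeasurable
    hF'.aestronglyMeasurable, hT.map_eq]

end Coordinates

theorem _root_.LipschitzOnWith.euclideanHausdorffMeasure_image_le {X Y : Type*} [EMetricSpace X]
    [EMetricSpace Y] [MeasurableSpace X] [BorelSpace X] [MeasurableSpace Y] [BorelSpace Y]
    {K : NNReal} {f : X → Y} {s : Set X} (h : LipschitzOnWith K f s) (d : ℕ) :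
    Measure.euclideanHausdorffMeasure d (f '' s) ≤
      (K : ENNReal) ^ d * Measure.euclideanHausdorffMeasure d s := by
  simp only [Measure.euclideanHausdorffMeasure_def, Measure.smul_apply, ENNReal.smul_def,
    smul_eq_mul]
  rw [mul_left_comm]
  gcongr
  simpa using h.hausdorffMeasure_image_le (d := (d : ℝ)) (by positivity)

/-! ### The boundary as a graph with small slope -/

/-- The open cylinder of radius and half-height `a` about `p`, with axis `n`. -/
def cylinder (n p : Space) (a : ℝ) : Set Space := {x | ‖shadow n (x - p)‖ < a ∧ |⟪n, x - p⟫| < a}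

theorem isOpen_cylinder (n p : Space) (a : ℝ) : IsOpen (cylinder n p a) := by
  have h1 : Continuous fun x => ‖shadow n (x - p)‖ := by fun_prop
  have h2 : Continuous fun x => |⟪n, x - p⟫| := by fun_prop
  exact (isOpen_lt h1 continuous_const).inter (isOpen_lt h2 continuous_const)

theorem mem_cylinder_self (n p : Space) {a : ℝ} (ha : 0 < a) : p ∈ cylinder n p a := by
  simp [cylinder, ha]

theorem add_smul_mem_ball {n p : Space} (hn : ‖n‖ = 1) {a R : ℝ} (haR : 2 * a < R)
    {y : (ℝ ∙ n)ᗮ} {t : ℝ} (hy : ‖y - shadow n p‖ ≤ a) (ht : |t - ⟪n, p⟫| ≤ a) :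
    (y : Space) + t • n ∈ Metric.ball p R := by
  rw [mem_ball_iff_norm]
  refine (norm_le_shadow_add hn _).trans_lt ?_
  rw [map_sub, shadow_add_smul hn, inner_sub_right, inner_add_smul hn]
  linarith

theorem cylinder_subset_ball {n p : Space} (hn : ‖n‖ = 1) {a R : ℝ} (haR : 2 * a < R) :
    cylinder n p a ⊆ Metric.ball p R := by
  intro x hx
  rw [← shadow_add_inner_smul hn x]
  refine add_smul_mem_ball hn haR ?_ ?_
  · rw [← map_sub]; exact hx.1.le
  · rw [← inner_sub_right]; exact hx.2.le

/-- `F` parametrizes the part of `{r = 0}` in the cylinder by its orthogonal projection to the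
plane `n^⊥`. -/
structure IsGraphParam (r : Space → ℝ) (n p : Space) (a δ : ℝ) (F : (ℝ ∙ n)ᗮ → Space) : Prop where
  mem_cylinder : ∀ y ∈ Metric.ball (shadow n p) a, F y ∈ cylinder n p a
  zero : ∀ y ∈ Metric.ball (shadow n p) a, r (F y) = 0
  shadow_eq : ∀ y ∈ Metric.ball (shadow n p) a, shadow n (F y) = y
  eq_of_zero : ∀ x ∈ cylinder n p a, r x = 0 → F (shadow n x) = x
  lipschitz : LipschitzOnWith (Real.toNNReal (1 - δ)⁻¹) F (Metric.ball (shadow n p) a)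

theorem shadow_mem_ball {n p : Space} {a : ℝ} {x : Space} (hx : x ∈ cylinder n p a) :
    shadow n x ∈ Metric.ball (shadow n p) a := by
  rw [mem_ball_iff_norm, ← map_sub]; exact hx.1

theorem IsFlatPatch.exists_isGraphParam {Ω : Set Space} {r : Space → ℝ} {n p : Space}
    {m δ a R : ℝ} (h : IsFlatPatch Ω (Metric.ball p R) r n m δ) (hrp : r p = 0) (hδ : δ ≤ 1 / 4)
    (ha : 0 < a) (haR : 2 * a < R) :
    ∃ F, IsGraphParam r n p a δ F := by
  have hn := h.norm_n
  have hpR : p ∈ Metric.ball p R := Metric.mem_ball_self (by linarith)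
  have hmδ : 0 < (1 - δ) * m := mul_pos (by linarith) h.m_pos
  have hex : ∀ y ∈ Metric.ball (shadow n p) a, ∃ t, |t - ⟪n, p⟫| < a ∧
      r ((y : Space) + t • n) = 0 := by
    intro y hy
    rw [mem_ball_iff_norm] at hy
    set s := ⟪n, p⟫
    have hval : ∀ t, |t - s| = a →
        |r ((y : Space) + t • n) - m * (t - s)| ≤ m * a / 2 := by
      intro t ht
      have hmem := add_smul_mem_ball hn haR hy.le ht.le
      have h1 := h.sub_close _ hmem p hpR
      have h3 : ‖(y : Space) + t • n - p‖ ≤ 2 * a := by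
        refine (norm_le_shadow_add hn _).trans ?_
        rw [map_sub, shadow_add_smul hn, inner_sub_right, inner_add_smul hn, ht]
        linarith
      rw [inner_sub_right, inner_add_smul hn, hrp, sub_zero] at h1
      refine h1.trans ?_
      have h4 : δ * m * ‖(y : Space) + t • n - p‖ ≤ 1 / 4 * m * ‖(y : Space) + t • n - p‖ := by
        gcongr
        exact h.m_pos.le
      nlinarith [h.m_pos]
    have hma : 0 < m * a := mul_pos h.m_pos ha
    have hlo : r ((y : Space) + (s - a) • n) < 0 := by
      have := (abs_le.1 (hval (s - a) (by rw [sub_sub_cancel_left, abs_neg, abs_of_pos ha]))).2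
      linarith
    have hhi : 0 < r ((y : Space) + (s + a) • n) := by
      have := (abs_le.1 (hval (s + a) (by rw [add_sub_cancel_left, abs_of_pos ha]))).1
      linarith
    have hcont : ContinuousOn (fun t : ℝ => r ((y : Space) + t • n)) (Icc (s - a) (s + a)) :=
      (h.smooth.continuous.comp (by fun_prop)).continuousOn
    obtain ⟨t, ht, ht0⟩ := intermediate_value_Ioo (by linarith) hcont ⟨hlo, hhi⟩
    exact ⟨t, abs_lt.2 ⟨by linarith [ht.1], by linarith [ht.2]⟩, ht0⟩
  choose! g hg hg0 using hex
  have hcyl : ∀ y ∈ Metric.ball (shadow n p) a, (y : Space) + g y • n ∈ cylinder n p a := by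
    intro y hy
    refine ⟨?_, ?_⟩
    · rw [map_sub, shadow_add_smul hn, ← mem_ball_iff_norm]; exact hy
    · rw [inner_sub_right, inner_add_smul hn]; exact hg y hy
  have hball := cylinder_subset_ball (p := p) hn haR
  refine ⟨fun y => (y : Space) + g y • n, hcyl, hg0, fun y _ => shadow_add_smul hn y _, ?_, ?_⟩
  · intro x hx hx0
    have hy := shadow_mem_ball hx
    have e1 := shadow_add_inner_smul hn x
    have hxb : (shadow n x : Space) + ⟪n, x⟫ • n ∈ Metric.ball p R := by rw [e1]; exact hball hx
    have hgb := hball (hcyl _ hy)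
    have hteq : g (shadow n x) = ⟪n, x⟫ := by
      rcases le_total (g (shadow n x)) ⟪n, x⟫ with hle | hle
      · have := h.slope_le hle hgb hxb
        rw [hg0 _ hy, e1, hx0] at this
        nlinarith
      · have := h.slope_le hle hxb hgb
        rw [hg0 _ hy, e1, hx0] at this
        nlinarith
    simp only [hteq, e1]
  · refine LipschitzOnWith.of_dist_le_mul fun y hy y' hy' => ?_
    rw [dist_eq_norm, dist_eq_norm, Real.coe_toNNReal _ (inv_nonneg.2 (by linarith))]
    set z := (y : Space) + g y • n
    set z' := (y' : Space) + g y' • n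
    have h1 := h.sub_close z (hball (hcyl y hy)) z' (hball (hcyl y' hy'))
    rw [hg0 y hy, hg0 y' hy', sub_self, zero_sub, abs_neg, abs_mul, abs_of_pos h.m_pos,
      mul_right_comm, mul_comm m] at h1
    have h2 := le_of_mul_le_mul_right h1 h.m_pos
    have h3 := norm_le_shadow_add hn (z - z')
    rw [map_sub, shadow_add_smul hn, shadow_add_smul hn] at h3
    rw [inv_mul_eq_div, le_div_iff₀ (by linarith)]
    linarith

namespace IsFlatPatch

variable {Ω : Set Space} {r : Space → ℝ} {n p : Space} {m δ a R : ℝ} {F : (ℝ ∙ n)ᗮ → Space}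

/-- The fundamental theorem of calculus along the lines in the direction `n`. -/
theorem setIntegral_fderivWithin_normal (h : IsFlatPatch Ω (Metric.ball p R) r n m δ)
    (hF : IsGraphParam r n p a δ F) (hδ : δ ≤ 1 / 4) (ha : 0 < a) (haR : 2 * a < R)
    (hΩ : IsSmoothDomain Ω) {K : Set Space} (hK : IsCompact K) (hKU : K ⊆ cylinder n p a)
    {f : Space → ℝ} (hf : ContDiffOn ℝ 1 f (closure Ω)) (h0 : ∀ x ∈ closure Ω \ K, f x = 0) :
    ∫ x in Ω, fderivWithin ℝ f (closure Ω) x n =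
      ∫ y in Metric.ball (shadow n p) a, f (F y) := by
  have hn := h.norm_n
  have hmδ : 0 < (1 - δ) * m := mul_pos (by linarith) h.m_pos
  have hball := cylinder_subset_ball (p := p) hn haR
  set D : Space → ℝ := fun x => fderivWithin ℝ f (closure Ω) x n with hD
  have hDcont : ContinuousOn D (closure Ω) := hΩ.continuousOn_fderivWithin_apply hf n
  have hD0 : ∀ x ∈ closure Ω \ K, D x = 0 := fun x hx => by
    rw [hD]; simp only; rw [fderivWithin_zero_off_compact hK h0 hx]; rfl
  have hint : Integrable (Ω.indicator D) :=
    (integrableOn_of_zero_off_compact_volume hΩ.1 hDcont hK hD0).integrable_indicator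
      hΩ.1.measurableSet
  rw [← integral_indicator hΩ.1.measurableSet, integral_eq_integral_plane_integral_line hn hint,
    ← integral_indicator Metric.isOpen_ball.measurableSet]
  refine integral_congr_ae (ae_of_all _ fun y => ?_)
  simp only
  by_cases hy : y ∈ Metric.ball (shadow n p) a
  swap
  · rw [indicator_of_notMem hy]
    have : ∀ t : ℝ, Ω.indicator D ((y : Space) + t • n) = 0 := by
      intro t
      by_cases ht : (y : Space) + t • n ∈ Ω
      · rw [indicator_of_mem ht]
        refine hD0 _ ⟨subset_closure ht, fun hK' => hy ?_⟩
        have := shadow_mem_ball (hKU hK')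
        rwa [shadow_add_smul hn] at this
      · exact indicator_of_notMem ht _
    simp [this]
  rw [indicator_of_mem hy]
  set s := ⟪n, p⟫ with hs
  set g := ⟪n, F y⟫ with hg
  have hFy : (y : Space) + g • n = F y := by
    have := shadow_add_inner_smul hn (F y)
    rwa [hF.shadow_eq y hy] at this
  have hgs : |g - s| < a := by
    have := (hF.mem_cylinder y hy).2
    rwa [inner_sub_right] at this
  obtain ⟨hg1, hg2⟩ := abs_lt.1 hgs
  have hyn : ‖y - shadow n p‖ ≤ a := (mem_ball_iff_norm.1 hy).le
  have hgb : (y : Space) + g • n ∈ Metric.ball p R := by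
    rw [hFy]; exact hball (hF.mem_cylinder y hy)
  have hr0 : r ((y : Space) + g • n) = 0 := by rw [hFy]; exact hF.zero y hy
  have hlt : ∀ t, s - a ≤ t → t < g → (y : Space) + t • n ∈ Ω := by
    intro t ht1 ht2
    have htb := add_smul_mem_ball hn haR hyn (abs_le.2 ⟨by linarith, by linarith⟩ : |t - s| ≤ a)
    rw [h.mem_iff _ htb]
    have := h.slope_le ht2.le htb hgb
    rw [hr0] at this
    nlinarith
  have hcl : ∀ t ∈ Icc (s - a) g, (y : Space) + t • n ∈ closure Ω := by
    intro t ht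
    rcases ht.2.lt_or_eq with h1 | h1
    · exact subset_closure (hlt t ht.1 h1)
    · rw [h1, h.mem_closure_iff hΩ.1 (by linarith) hgb, hr0]
  have hzero : ∀ t ∉ Ioc (s - a) g, Ω.indicator D ((y : Space) + t • n) = 0 := by
    intro t ht
    by_cases hmem : (y : Space) + t • n ∈ Ω
    swap
    · exact indicator_of_notMem hmem _
    rw [indicator_of_mem hmem]
    refine hD0 _ ⟨subset_closure hmem, fun hK' => ht ?_⟩
    have hc := hKU hK'
    have hc2 := hc.2
    rw [inner_sub_right, inner_add_smul hn] at hc2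
    obtain ⟨h1, h2⟩ := abs_lt.1 hc2
    refine ⟨by linarith, ?_⟩
    by_contra hcon
    have hcon := not_le.1 hcon
    have h3 := h.slope_le hcon.le hgb (hball hc)
    rw [hr0] at h3
    have h4 := (h.mem_iff _ (hball hc)).1 hmem
    nlinarith
  have e1 : ∫ t : ℝ, Ω.indicator D ((y : Space) + t • n) =
      ∫ t in (s - a)..g, Ω.indicator D ((y : Space) + t • n) := by
    rw [intervalIntegral.integral_of_le (by linarith), setIntegral_eq_integral_of_forall_compl_eq_zero
      hzero]
  have hIoo : ∀ t ∈ Ioo (s - a) g, Ω.indicator D ((y : Space) + t • n) =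
      D ((y : Space) + t • n) := fun t ht => indicator_of_mem (hlt t ht.1.le ht.2) _
  have hline : Continuous fun t : ℝ => (y : Space) + t • n := by fun_prop
  have hDline : ContinuousOn (fun t : ℝ => D ((y : Space) + t • n)) (Icc (s - a) g) :=
    hDcont.comp hline.continuousOn hcl
  have e2 : ∫ t in (s - a)..g, Ω.indicator D ((y : Space) + t • n) =
      f ((y : Space) + g • n) - f ((y : Space) + (s - a) • n) := by
    refine intervalIntegral.integral_eq_sub_of_hasDerivAt_of_le (by linarith)
      (f := fun t : ℝ => f ((y : Space) + t • n))
      (hf.continuousOn.comp hline.continuousOn hcl) ?_ ?_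
    · intro t ht
      rw [hIoo t ht]
      have hmem := hlt t ht.1.le ht.2
      have hfd : DifferentiableAt ℝ f ((y : Space) + t • n) :=
        (hf.contDiffAt (mem_of_superset (hΩ.1.mem_nhds hmem) subset_closure)).differentiableAt
          one_ne_zero
      have hl : HasDerivAt (fun t : ℝ => (y : Space) + t • n) n t := by
        simpa using ((hasDerivAt_id t).smul_const n).const_add (y : Space)
      simp only [hD]
      rw [fderivWithin_closure_eq hΩ.1 f hmem]
      exact hfd.hasFDerivAt.comp_hasDerivAt t hl
    · have : IntervalIntegrable (fun t : ℝ => D ((y : Space) + t • n)) volume (s - a) g :=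
        ContinuousOn.intervalIntegrable (by rwa [uIcc_of_le (by linarith)])
      rw [intervalIntegrable_iff_integrableOn_Ioo_of_le (by linarith)] at this ⊢
      exact this.congr_fun (fun t ht => (hIoo t ht).symm) measurableSet_Ioo
  have e3 : f ((y : Space) + (s - a) • n) = 0 := by
    refine h0 _ ⟨hcl _ ⟨le_rfl, by linarith⟩, fun hK' => ?_⟩
    have := (hKU hK').2
    rw [inner_sub_right, inner_add_smul hn, ← hs, sub_sub_cancel_left, abs_neg,
      abs_of_pos ha] at this
    exact lt_irrefl _ this
  rw [e1, e2, e3, sub_zero, hFy]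

theorem frontier_inter_cylinder (h : IsFlatPatch Ω (Metric.ball p R) r n m δ) (hδ : δ ≤ 1 / 4)
    (haR : 2 * a < R) (hΩ : IsSmoothDomain Ω) :
    frontier Ω ∩ cylinder n p a = {x | r x = 0} ∩ cylinder n p a := by
  ext x
  simp only [mem_inter_iff, mem_ofPred_eq, and_congr_left_iff]
  exact fun hx => h.mem_frontier_iff hΩ.1 (by linarith) (cylinder_subset_ball h.norm_n haR hx)

/-- The projection to the plane `n^⊥` does not increase area. -/
theorem volume_le_map_shadow (h : IsFlatPatch Ω (Metric.ball p R) r n m δ)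
    (hF : IsGraphParam r n p a δ F) (hδ : δ ≤ 1 / 4) (haR : 2 * a < R) (hΩ : IsSmoothDomain Ω) :
    volume.restrict (Metric.ball (shadow n p) a) ≤
      Measure.map (shadow n) (area.restrict (frontier Ω ∩ cylinder n p a)) := by
  refine Measure.le_iff.2 fun A hA => ?_
  have hpre : MeasurableSet (shadow n ⁻¹' A) := (shadow n).continuous.measurable hA
  rw [Measure.map_apply (shadow n).continuous.measurable hA, Measure.restrict_apply hA,
    Measure.restrict_apply hpre, volume_plane_eq_area h.norm_n,
    h.frontier_inter_cylinder hδ haR hΩ]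
  have hsub : A ∩ Metric.ball (shadow n p) a ⊆
      shadow n '' (shadow n ⁻¹' A ∩ ({x | r x = 0} ∩ cylinder n p a)) := by
    rintro y ⟨hyA, hy⟩
    exact ⟨F y, ⟨by rw [mem_preimage, hF.shadow_eq y hy]; exact hyA, hF.zero y hy,
      hF.mem_cylinder y hy⟩, hF.shadow_eq y hy⟩
  refine (measure_mono hsub).trans ?_
  have hl := ((ℝ ∙ n)ᗮ.lipschitzWith_orthogonalProjectionOnto).lipschitzOnWith
    (s := shadow n ⁻¹' A ∩ ({x | r x = 0} ∩ cylinder n p a))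
  simpa using hl.euclideanHausdorffMeasure_image_le 2

/-- The projection to the plane `n^⊥` decreases area by at most the factor `(1 - δ)²`. -/
theorem map_shadow_le (h : IsFlatPatch Ω (Metric.ball p R) r n m δ)
    (hF : IsGraphParam r n p a δ F) (hδ : δ ≤ 1 / 4) (haR : 2 * a < R) (hΩ : IsSmoothDomain Ω) :
    Measure.map (shadow n) (area.restrict (frontier Ω ∩ cylinder n p a)) ≤
      ENNReal.ofReal ((1 - δ)⁻¹ ^ 2) • volume.restrict (Metric.ball (shadow n p) a) := by
  refine Measure.le_iff.2 fun A hA => ?_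
  have hpre : MeasurableSet (shadow n ⁻¹' A) := (shadow n).continuous.measurable hA
  rw [Measure.map_apply (shadow n).continuous.measurable hA, Measure.smul_apply,
    Measure.restrict_apply hA,
    Measure.restrict_apply hpre, volume_plane_eq_area h.norm_n,
    h.frontier_inter_cylinder hδ haR hΩ]
  have hsub : shadow n ⁻¹' A ∩ ({x | r x = 0} ∩ cylinder n p a) ⊆
      F '' (A ∩ Metric.ball (shadow n p) a) := by
    rintro x ⟨hxA, hx0, hx⟩
    exact ⟨shadow n x, ⟨hxA, shadow_mem_ball hx⟩, hF.eq_of_zero x hx hx0⟩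
  refine (measure_mono hsub).trans ?_
  have := (hF.lipschitz.mono inter_subset_right).euclideanHausdorffMeasure_image_le 2
    (s := A ∩ Metric.ball (shadow n p) a)
  rw [smul_eq_mul, ENNReal.ofReal_pow (inv_nonneg.2 (by linarith))]
  exact this

theorem area_inter_cylinder_lt_top (h : IsFlatPatch Ω (Metric.ball p R) r n m δ)
    (hF : IsGraphParam r n p a δ F) (hδ : δ ≤ 1 / 4) (haR : 2 * a < R) (hΩ : IsSmoothDomain Ω) :
    area (frontier Ω ∩ cylinder n p a) < ⊤ := by
  have := h.map_shadow_le hF hδ haR hΩ univ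
  rw [Measure.map_apply (shadow n).continuous.measurable MeasurableSet.univ, preimage_univ,
    Measure.restrict_apply_univ, Measure.smul_apply, Measure.restrict_apply_univ] at this
  exact this.trans_lt (ENNReal.mul_lt_top ENNReal.ofReal_lt_top measure_ball_lt_top)

end IsFlatPatch

/-! ### The divergence theorem in a flat patch, up to a small error -/

/-- Integrals against two comparable measures differ by a small multiple of the integral of the
absolute value. -/
theorem abs_integral_sub_integral_le {α : Type*} [MeasurableSpace α] {μ ν : Measure α} {c : ℝ}
    (hc : 0 < c) (h₁ : μ ≤ ν) (h₂ : ν ≤ ENNReal.ofReal c • μ) {ψ : α → ℝ} (hψ : Integrable ψ ν) :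
    |∫ x, ψ x ∂μ - ∫ x, ψ x ∂ν| ≤ (1 - c⁻¹) * ∫ x, |ψ x| ∂ν := by
  have hμ : Integrable ψ μ := hψ.mono_measure h₁
  have hp : ∫ x, (|ψ x| + ψ x) ∂μ ≤ ∫ x, (|ψ x| + ψ x) ∂ν :=
    integral_mono_measure h₁ (ae_of_all _ fun x => by
      simp only [Pi.zero_apply]; linarith [neg_abs_le (ψ x)]) (hψ.abs.add hψ)
  have hm : ∫ x, (|ψ x| - ψ x) ∂μ ≤ ∫ x, (|ψ x| - ψ x) ∂ν :=
    integral_mono_measure h₁ (ae_of_all _ fun x => by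
      simp only [Pi.zero_apply]; linarith [le_abs_self (ψ x)]) (hψ.abs.sub hψ)
  rw [integral_add hμ.abs hμ, integral_add hψ.abs hψ] at hp
  rw [integral_sub hμ.abs hμ, integral_sub hψ.abs hψ] at hm
  have hu : ∫ x, |ψ x| ∂ν ≤ c * ∫ x, |ψ x| ∂μ := by
    have := integral_mono_measure h₂ (ae_of_all _ fun x => abs_nonneg (ψ x))
      (hμ.abs.smul_measure ENNReal.ofReal_ne_top)
    rwa [integral_smul_measure, ENNReal.toReal_ofReal hc.le, smul_eq_mul] at this
  have hu' : c⁻¹ * ∫ x, |ψ x| ∂ν ≤ ∫ x, |ψ x| ∂μ := by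
    rwa [inv_mul_le_iff₀ hc]
  rw [abs_le]
  constructor <;> linarith

theorem measurableSet_frontier_inter_cylinder {Ω : Set Space} (n p : Space) (a : ℝ) :
    MeasurableSet (frontier Ω ∩ cylinder n p a) :=
  isClosed_frontier.measurableSet.inter (isOpen_cylinder n p a).measurableSet

namespace IsFlatPatch

variable {Ω : Set Space} {r : Space → ℝ} {n p : Space} {m δ a R : ℝ} {F : (ℝ ∙ n)ᗮ → Space}

/-- A surface integral over the graph, computed in the plane of the parameters. -/
theorem integral_frontier_eq (h : IsFlatPatch Ω (Metric.ball p R) r n m δ)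
    (hF : IsGraphParam r n p a δ F) (hδ : δ ≤ 1 / 4) (haR : 2 * a < R) (hΩ : IsSmoothDomain Ω)
    {K : Set Space} (hK : IsCompact K) (hKU : K ⊆ cylinder n p a) {φ : Space → ℝ}
    (hφ : ContinuousOn φ (frontier Ω)) (h0 : ∀ x ∈ frontier Ω \ K, φ x = 0) :
    Integrable (fun y => φ (F y))
      (Measure.map (shadow n) (area.restrict (frontier Ω ∩ cylinder n p a))) ∧
    ∫ x in frontier Ω, φ x ∂area = ∫ y, φ (F y)
      ∂(Measure.map (shadow n) (area.restrict (frontier Ω ∩ cylinder n p a))) := by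
  set μ := area.restrict (frontier Ω ∩ cylinder n p a) with hμ
  have hms := measurableSet_frontier_inter_cylinder (Ω := Ω) n p a
  have hsm : Measurable (shadow n) := (shadow n).continuous.measurable
  have hac : Measure.map (shadow n) μ ≪ volume.restrict (Metric.ball (shadow n p) a) :=
    (Measure.absolutelyContinuous_of_le (h.map_shadow_le hF hδ haR hΩ)).trans
      Measure.smul_absolutelyContinuous
  have hmaps : MapsTo F (Metric.ball (shadow n p) a) (frontier Ω) := fun y hy => by
    have : F y ∈ frontier Ω ∩ cylinder n p a := by
      rw [h.frontier_inter_cylinder hδ haR hΩ]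
      exact ⟨hF.zero y hy, hF.mem_cylinder y hy⟩
    exact this.1
  have hcont : ContinuousOn (fun y => φ (F y)) (Metric.ball (shadow n p) a) :=
    hφ.comp hF.lipschitz.continuousOn hmaps
  have hmeas : AEStronglyMeasurable (fun y => φ (F y)) (Measure.map (shadow n) μ) :=
    (hcont.aestronglyMeasurable Metric.isOpen_ball.measurableSet).mono_ac hac
  have hae : ∀ᵐ x ∂μ, φ (F (shadow n x)) = φ x := by
    refine (ae_restrict_iff' hms).2 (ae_of_all _ fun x hx => ?_)
    rw [h.frontier_inter_cylinder hδ haR hΩ] at hx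
    rw [hF.eq_of_zero x hx.2 hx.1]
  have hfin : IsFiniteMeasure μ :=
    ⟨by rw [hμ, Measure.restrict_apply_univ]; exact h.area_inter_cylinder_lt_top hF hδ haR hΩ⟩
  have hint : Integrable φ μ := by
    have hK' : IsCompact (frontier Ω ∩ K) := hK.inter_left isClosed_frontier
    obtain ⟨C, hC⟩ := hK'.exists_bound_of_continuousOn (hφ.mono inter_subset_left)
    refine Integrable.of_bound ((hφ.mono inter_subset_left).aestronglyMeasurable hms) (max C 0) ?_
    refine (ae_restrict_iff' hms).2 (ae_of_all _ fun x hx => ?_)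
    by_cases hxK : x ∈ K
    · exact (hC x ⟨hx.1, hxK⟩).trans (le_max_left _ _)
    · rw [h0 x ⟨hx.1, hxK⟩, norm_zero]
      exact le_max_right _ _
  refine ⟨?_, ?_⟩
  · rw [integrable_map_measure hmeas hsm.aemeasurable]
    exact hint.congr (hae.mono fun x hx => hx.symm)
  · rw [integral_map hsm.aemeasurable hmeas, integral_congr_ae hae, hμ]
    refine (setIntegral_eq_of_subset_of_forall_sdiff_eq_zero (μ := area) (f := φ)
      isClosed_frontier.measurableSet (inter_subset_left (t := cylinder n p a)) ?_)
    rintro x ⟨hx, hx'⟩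
    exact h0 x ⟨hx, fun hxK => hx' ⟨hx, hKU hxK⟩⟩

/-- In a flat patch the relative slope is close to the corresponding component of the normal. -/
theorem slope_sub_normal_le (h : IsFlatPatch Ω (Metric.ball p R) r n m δ) (hδ0 : 0 < δ)
    (hδ : δ ≤ 1 / 4) (hΩ : IsOpen Ω) {x : Space} (hx : x ∈ Metric.ball p R)
    (hxf : x ∈ frontier Ω) (e : Space) :
    |fderiv ℝ r x e / fderiv ℝ r x n| ≤ 2 * ‖e‖ ∧
    |fderiv ℝ r x e / fderiv ℝ r x n - ⟪outwardNormal Ω x, e⟫| ≤ 4 * δ * ‖e‖ := by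
  rw [(h.isDefiningFunction hΩ (by linarith) hx hxf).outwardNormal_eq, real_inner_smul_left,
    ← inner_gradient_left, ← inner_gradient_left]
  have hm := h.m_pos
  have h1 := h.le_inner_gradient hx
  have h2 := h.norm_gradient_le hx
  have h3 : |⟪gradient r x, e⟫| ≤ ‖gradient r x‖ * ‖e‖ := abs_real_inner_le_norm _ _
  have h4 : ⟪gradient r x, n⟫ ≤ ‖gradient r x‖ := by
    have := real_inner_le_norm (gradient r x) n
    rwa [h.norm_n, mul_one] at this
  set G := ‖gradient r x‖
  set q := ⟪gradient r x, n⟫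
  set E := ⟪gradient r x, e⟫
  have hq : 0 < q := by nlinarith
  have hG : 0 < G := hq.trans_le h4
  have he := norm_nonneg e
  have hG2 : G ≤ 2 * q := by nlinarith
  constructor
  · rw [abs_div, abs_of_pos hq, div_le_iff₀ hq]
    nlinarith
  · have : E / q - G⁻¹ * E = E * (G - q) / (q * G) := by
      field_simp
    rw [this, abs_div, abs_mul, abs_of_pos (mul_pos hq hG), abs_of_nonneg (sub_nonneg.2 h4),
      div_le_iff₀ (mul_pos hq hG)]
    have h5 : G - q ≤ 4 * δ * q := by nlinarith
    calc |E| * (G - q) ≤ (G * ‖e‖) * (4 * δ * q) := by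
          gcongr
      _ = 4 * δ * ‖e‖ * (q * G) := by ring

/-- The divergence theorem in a flat patch, up to an error proportional to the slope. -/
theorem abs_setIntegral_sub_le (h : IsFlatPatch Ω (Metric.ball p R) r n m δ) (hrp : r p = 0)
    (hδ0 : 0 < δ) (hδ : δ ≤ 1 / 4) (ha : 0 < a) (haR : 2 * a < R) (hΩ : IsSmoothDomain Ω)
    {K : Set Space} (hK : IsCompact K) (hKU : K ⊆ cylinder n p a) {f : Space → ℝ}
    (hf : ContDiffOn ℝ 1 f (closure Ω)) (h0 : ∀ x ∈ closure Ω \ K, f x = 0) (e : Space) :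
    |(∫ x in Ω, fderivWithin ℝ f (closure Ω) x e) -
      ∫ x in frontier Ω, f x * ⟪outwardNormal Ω x, e⟫ ∂area| ≤
    8 * δ * ‖e‖ * ∫ x in frontier Ω, |f x| ∂area := by
  obtain ⟨F, hF⟩ := h.exists_isGraphParam hrp hδ ha haR
  have hball := cylinder_subset_ball (p := p) h.norm_n haR
  have hδ1 : δ < 1 := by linarith
  set w : Space → ℝ := fun x => fderiv ℝ r x e / fderiv ℝ r x n with hw
  have hfw : ContDiffOn ℝ 1 (fun x => f x * w x) (closure Ω) :=
    contDiffOn_mul_of_zero_off_compact hK h.isOpen (hKU.trans hball) hf h0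
      (h.contDiffOn_slope hδ1 e)
  have h0w : ∀ x ∈ closure Ω \ K, f x * w x = 0 := fun x hx => by rw [h0 x hx, zero_mul]
  have hfc : frontier Ω ⊆ closure Ω := frontier_subset_closure
  have h0f : ∀ x ∈ frontier Ω \ K, f x = 0 := fun x hx => h0 x ⟨hfc hx.1, hx.2⟩
  rw [h.setIntegral_fderivWithin_eq hδ1 hΩ hK (hKU.trans hball) hf h0 e,
    h.setIntegral_fderivWithin_normal hF hδ ha haR hΩ hK hKU hfw h0w]
  obtain ⟨i₁, -⟩ := h.integral_frontier_eq hF hδ haR hΩ hK hKU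
    (hfw.continuousOn.mono hfc) (fun x hx => h0w x ⟨hfc hx.1, hx.2⟩)
  obtain ⟨i₂, e₂⟩ := h.integral_frontier_eq hF hδ haR hΩ hK hKU
    (φ := fun x => f x * ⟪outwardNormal Ω x, e⟫)
    ((hf.continuousOn.mono hfc).mul (hΩ.continuousOn_outwardNormal.inner continuousOn_const))
    (fun x hx => by rw [h0f x hx, zero_mul])
  obtain ⟨i₃, e₃⟩ := h.integral_frontier_eq hF hδ haR hΩ hK hKU
    (φ := fun x => |f x|) (hf.continuousOn.mono hfc).abs
    (fun x hx => by rw [h0f x hx, abs_zero])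
  rw [e₂, e₃]
  set κ := Measure.map (shadow n) (area.restrict (frontier Ω ∩ cylinder n p a))
  have hac : κ ≪ volume.restrict (Metric.ball (shadow n p) a) :=
    (Measure.absolutelyContinuous_of_le (h.map_shadow_le hF hδ haR hΩ)).trans
      Measure.smul_absolutelyContinuous
  have hae : ∀ᵐ y ∂κ, |f (F y) * w (F y)| ≤ 2 * ‖e‖ * |f (F y)| ∧
      |f (F y) * w (F y) - f (F y) * ⟪outwardNormal Ω (F y), e⟫| ≤
        4 * δ * ‖e‖ * |f (F y)| := by
    refine hac.ae_le ((ae_restrict_iff' Metric.isOpen_ball.measurableSet).2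
      (ae_of_all _ fun y hy => ?_))
    have hFy : F y ∈ frontier Ω ∩ cylinder n p a := by
      rw [h.frontier_inter_cylinder hδ haR hΩ]
      exact ⟨hF.zero y hy, hF.mem_cylinder y hy⟩
    obtain ⟨s₁, s₂⟩ := h.slope_sub_normal_le hδ0 hδ hΩ.1 (hball hFy.2) hFy.1 e
    rw [← mul_sub, abs_mul, abs_mul, mul_comm, mul_comm |f (F y)|]
    exact ⟨by gcongr, by gcongr⟩
  have hmeas := abs_integral_sub_integral_le (c := (1 - δ)⁻¹ ^ 2)
    (pow_pos (inv_pos.2 (by linarith)) 2) (h.volume_le_map_shadow hF hδ haR hΩ)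
    (h.map_shadow_le hF hδ haR hΩ) i₁
  have hA : ∫ y, |f (F y) * w (F y)| ∂κ ≤ 2 * ‖e‖ * ∫ y, |f (F y)| ∂κ := by
    rw [← integral_const_mul]
    exact integral_mono_ae i₁.abs (i₃.const_mul _) (hae.mono fun y hy => hy.1)
  have hB : |∫ y, f (F y) * w (F y) ∂κ - ∫ y, f (F y) * ⟪outwardNormal Ω (F y), e⟫ ∂κ| ≤
      4 * δ * ‖e‖ * ∫ y, |f (F y)| ∂κ := by
    rw [← integral_sub i₁ i₂, ← integral_const_mul]
    refine abs_integral_le_integral_abs.trans ?_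
    exact integral_mono_ae (i₁.sub i₂).abs (i₃.const_mul _) (hae.mono fun y hy => hy.2)
  have hI : 0 ≤ ∫ y, |f (F y) * w (F y)| ∂κ := integral_nonneg fun y => abs_nonneg _
  have hc : 1 - ((1 - δ)⁻¹ ^ 2)⁻¹ ≤ 2 * δ := by
    rw [inv_pow, inv_inv]
    nlinarith
  calc _ ≤ |(∫ y in Metric.ball (shadow n p) a, f (F y) * w (F y)) -
          ∫ y, f (F y) * w (F y) ∂κ| +
        |∫ y, f (F y) * w (F y) ∂κ - ∫ y, f (F y) * ⟪outwardNormal Ω (F y), e⟫ ∂κ| :=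
        abs_sub_le _ _ _
    _ ≤ 2 * δ * (2 * ‖e‖ * ∫ y, |f (F y)| ∂κ) + 4 * δ * ‖e‖ * ∫ y, |f (F y)| ∂κ := by
        refine add_le_add (hmeas.trans ?_) hB
        exact (mul_le_mul_of_nonneg_right hc hI).trans
          (mul_le_mul_of_nonneg_left hA (by linarith))
    _ = _ := by ring

end IsFlatPatch

/-! ### The divergence theorem -/

namespace IsSmoothDomain

variable {Ω : Set Space}

theorem exists_cylinder (hΩ : IsSmoothDomain Ω) {p : Space} (hp : p ∈ frontier Ω) {δ : ℝ}
    (hδ : 0 < δ) : ∃ r n m a R, 0 < a ∧ 2 * a < R ∧ r p = 0 ∧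
      IsFlatPatch Ω (Metric.ball p R) r n m δ := by
  obtain ⟨r, n, m, R, hR, hrp, hf⟩ := hΩ.exists_isFlatPatch hp hδ
  exact ⟨r, n, m, R / 4, R, by linarith, by linarith, hrp, hf⟩

/-- Compact parts of the boundary have finite area. -/
theorem area_frontier_inter_lt_top (hΩ : IsSmoothDomain Ω) {K : Set Space} (hK : IsCompact K) :
    area (frontier Ω ∩ K) < ⊤ := by
  refine (hK.inter_left isClosed_frontier).measure_lt_top_of_nhdsWithin fun p hp => ?_
  obtain ⟨r, n, m, a, R, ha, haR, hrp, hf⟩ :=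
    hΩ.exists_cylinder hp.1 (δ := 1 / 4) (by norm_num)
  obtain ⟨F, hF⟩ := hf.exists_isGraphParam hrp le_rfl ha haR
  refine ⟨frontier Ω ∩ cylinder n p a, ?_, hf.area_inter_cylinder_lt_top hF le_rfl haR hΩ⟩
  exact inter_mem (mem_of_superset self_mem_nhdsWithin inter_subset_left)
    (mem_nhdsWithin_of_mem_nhds ((isOpen_cylinder n p a).mem_nhds (mem_cylinder_self n p ha)))

theorem integrableOn_frontier (hΩ : IsSmoothDomain Ω) {K : Set Space} (hK : IsCompact K)
    {φ : Space → ℝ} (hφ : ContinuousOn φ (frontier Ω)) (h0 : ∀ x ∈ frontier Ω \ K, φ x = 0) :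
    IntegrableOn φ (frontier Ω) area := by
  have hcl : closure (frontier Ω) = frontier Ω := isClosed_frontier.closure_eq
  exact integrableOn_of_zero_off_compact (Ω := frontier Ω) (by rwa [hcl])
    isClosed_frontier.measurableSet subset_closure hK (hΩ.area_frontier_inter_lt_top hK)
    (by rwa [hcl])

/-- The divergence theorem for functions supported near a point, up to an arbitrarily small
relative error. -/
theorem exists_nhds_abs_setIntegral_sub_le (hΩ : IsSmoothDomain Ω) {p : Space}
    (hp : p ∈ closure Ω) {ε : ℝ} (hε : 0 < ε) (e : Space) :
    ∃ U, IsOpen U ∧ p ∈ U ∧ ∀ K, IsCompact K → K ⊆ U → ∀ f : Space → ℝ,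
      ContDiffOn ℝ 1 f (closure Ω) → (∀ x ∈ closure Ω \ K, f x = 0) →
      |(∫ x in Ω, fderivWithin ℝ f (closure Ω) x e) -
        ∫ x in frontier Ω, f x * ⟪outwardNormal Ω x, e⟫ ∂area| ≤
      ε * ‖e‖ * ∫ x in frontier Ω, |f x| ∂area := by
  by_cases hpΩ : p ∈ Ω
  · refine ⟨Ω, hΩ.1, hpΩ, fun K hK hKΩ f hf h0 => ?_⟩
    have h1 : ∫ x in Ω, fderivWithin ℝ f (closure Ω) x e = 0 := by
      rw [← setIntegral_fderiv_eq_zero hΩ.1 hK hKΩ (hf.mono subset_closure)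
        (fun x hx => h0 x ⟨subset_closure hx.1, hx.2⟩) e]
      refine setIntegral_congr_fun hΩ.1.measurableSet fun x hx => ?_
      rw [fderivWithin_closure_eq hΩ.1 f hx]
    have h2 : ∫ x in frontier Ω, f x * ⟪outwardNormal Ω x, e⟫ ∂area = 0 := by
      refine setIntegral_eq_zero_of_forall_eq_zero fun x hx => ?_
      rw [hΩ.1.frontier_eq] at hx
      rw [h0 x ⟨hx.1, fun h => hx.2 (hKΩ h)⟩, zero_mul]
    rw [h1, h2, sub_self, abs_zero]
    have : 0 ≤ ∫ x in frontier Ω, |f x| ∂area := integral_nonneg fun x => abs_nonneg _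
    positivity
  · have hpf : p ∈ frontier Ω := by rw [hΩ.1.frontier_eq]; exact ⟨hp, hpΩ⟩
    have hδ : 0 < min (1 / 4) (ε / 8) := by positivity
    obtain ⟨r, n, m, a, R, ha, haR, hrp, hf⟩ := hΩ.exists_cylinder hpf hδ
    refine ⟨cylinder n p a, isOpen_cylinder n p a, mem_cylinder_self n p ha,
      fun K hK hKU f hfs h0 => ?_⟩
    refine (hf.abs_setIntegral_sub_le hrp hδ (min_le_left _ _) ha haR hΩ hK hKU hfs h0 e).trans ?_
    have : 0 ≤ ∫ x in frontier Ω, |f x| ∂area := integral_nonneg fun x => abs_nonneg _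
    have h8 : 8 * min (1 / 4) (ε / 8) ≤ ε := by linarith [min_le_right (1 / 4) (ε / 8)]
    gcongr

open scoped Manifold in
/-- The divergence theorem for a field of constant direction `e`. -/
theorem setIntegral_fderivWithin (hΩ : IsSmoothDomain Ω) {K : Set Space} (hK : IsCompact K)
    {f : Space → ℝ} (hf : ContDiffOn ℝ 1 f (closure Ω)) (h0 : ∀ x ∈ closure Ω \ K, f x = 0)
    (e : Space) :
    ∫ x in Ω, fderivWithin ℝ f (closure Ω) x e =
      ∫ x in frontier Ω, f x * ⟪outwardNormal Ω x, e⟫ ∂area := by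
  have hfc : frontier Ω ⊆ closure Ω := frontier_subset_closure
  set A := ∫ x in frontier Ω, |f x| ∂area with hA
  have main : ∀ ε : ℝ, 0 < ε → |(∫ x in Ω, fderivWithin ℝ f (closure Ω) x e) -
      ∫ x in frontier Ω, f x * ⟪outwardNormal Ω x, e⟫ ∂area| ≤ ε * ‖e‖ * A := by
    intro ε hε
    have hex : ∀ p ∈ closure Ω, _ := fun p hp =>
      hΩ.exists_nhds_abs_setIntegral_sub_le hp hε e
    choose! U hUo hpU hU using hex
    have hK₁ : IsCompact (K ∩ closure Ω) := hK.inter_right isClosed_closure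
    obtain ⟨t, ht, hcov⟩ := hK₁.elim_nhds_subcover U
      (fun p hp => (hUo p hp.2).mem_nhds (hpU p hp.2))
    obtain ⟨ρ, hρ⟩ := SmoothPartitionOfUnity.exists_isSubordinate 𝓘(ℝ, Space) hK₁.isClosed
      (fun i : t => U i) (fun i => hUo i (ht i i.2).2) (by simpa [iUnion_subtype] using hcov)
    have hρs : ∀ i, ContDiff ℝ 1 (ρ i) := fun i =>
      (ρ i).contMDiff.contDiff.of_le (by norm_cast)
    have hsum : ∀ x ∈ closure Ω, f x = ∑ i, f x * ρ i x := by
      intro x hx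
      by_cases hxK : x ∈ K
      · rw [← Finset.mul_sum, ← finsum_eq_sum_of_fintype, ρ.sum_eq_one ⟨hxK, hx⟩, mul_one]
      · simp [h0 x ⟨hx, hxK⟩]
    have hfi : ∀ i, ContDiffOn ℝ 1 (fun x => f x * ρ i x) (closure Ω) := fun i =>
      hf.mul (hρs i).contDiffOn
    have hKi : ∀ i, IsCompact (K ∩ tsupport (ρ i)) := fun i =>
      hK.inter_right (isClosed_tsupport _)
    have h0i : ∀ i, ∀ x ∈ closure Ω \ (K ∩ tsupport (ρ i)), f x * ρ i x = 0 := by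
      rintro i x ⟨hx, hx'⟩
      by_cases hxK : x ∈ K
      · rw [image_eq_zero_of_notMem_tsupport (fun h => hx' ⟨hxK, h⟩), mul_zero]
      · rw [h0 x ⟨hx, hxK⟩, zero_mul]
    have hest := fun i : t => hU i (ht i i.2).2 _ (hKi i)
      (inter_subset_right.trans (hρ i)) _ (hfi i) (h0i i)
    have e₁ : ∫ x in Ω, fderivWithin ℝ f (closure Ω) x e =
        ∑ i, ∫ x in Ω, fderivWithin ℝ (fun x => f x * ρ i x) (closure Ω) x e := by
      rw [← integral_finsetSum _ fun i _ => hΩ.integrableOn_fderivWithin (hfi i) (hKi i) (h0i i) e]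
      refine setIntegral_congr_fun hΩ.1.measurableSet fun x hx => ?_
      have hx' := subset_closure hx
      rw [fderivWithin_congr hsum (hsum x hx'), fderivWithin_fun_sum
          (hΩ.uniqueDiffOn_closure x hx')
          (fun i _ => ((hfi i).differentiableOn one_ne_zero) x hx')]
      simp
    have e₂ : ∫ x in frontier Ω, f x * ⟪outwardNormal Ω x, e⟫ ∂area =
        ∑ i, ∫ x in frontier Ω, f x * ρ i x * ⟪outwardNormal Ω x, e⟫ ∂area := by
      rw [← integral_finsetSum _ fun i _ => hΩ.integrableOn_frontier (hKi i)
        (φ := fun x => f x * ρ i x * ⟪outwardNormal Ω x, e⟫) (((hfi i).continuousOn.mono hfc).mul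
          (hΩ.continuousOn_outwardNormal.inner continuousOn_const))
        (fun x hx => by rw [h0i i x ⟨hfc hx.1, hx.2⟩, zero_mul])]
      refine setIntegral_congr_fun isClosed_frontier.measurableSet fun x hx => ?_
      rw [← Finset.sum_mul, ← hsum x (hfc hx)]
    have e₃ : A = ∑ i, ∫ x in frontier Ω, |f x * ρ i x| ∂area := by
      rw [hA, ← integral_finsetSum _ fun i _ => hΩ.integrableOn_frontier (hKi i)
        (φ := fun x => |f x * ρ i x|) ((hfi i).continuousOn.mono hfc).abs
        (fun x hx => by rw [h0i i x ⟨hfc hx.1, hx.2⟩, abs_zero])]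
      refine setIntegral_congr_fun isClosed_frontier.measurableSet fun x hx => ?_
      by_cases hxK : x ∈ K
      · simp_rw [abs_mul, abs_of_nonneg (ρ.nonneg _ x)]
        rw [← Finset.mul_sum, ← finsum_eq_sum_of_fintype, ρ.sum_eq_one ⟨hxK, hfc hx⟩, mul_one]
      · simp [h0 x ⟨hfc hx, hxK⟩]
    rw [e₁, e₂, e₃, ← Finset.sum_sub_distrib, Finset.mul_sum]
    exact (Finset.abs_sum_le_sum_abs _ _).trans (Finset.sum_le_sum fun i _ => hest i)
  have hlim : Tendsto (fun ε : ℝ => ε * ‖e‖ * A) (𝓝[>] 0) (𝓝 0) := by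
    have : Continuous fun ε : ℝ => ε * ‖e‖ * A := by fun_prop
    have h1 := this.tendsto 0
    simp only [zero_mul] at h1
    exact h1.mono_left nhdsWithin_le_nhds
  have hle := ge_of_tendsto hlim (by
    filter_upwards [self_mem_nhdsWithin] with ε hε using main ε hε)
  exact sub_eq_zero.1 (abs_nonpos_iff.1 hle)

end IsSmoothDomain

/-! ### Green's identities -/

/-- The Laplace equation, with derivatives taken within the closure. -/
theorem sum_fderivWithin_fderivWithin_eq_zero (hΩ : IsOpen Ω) {Φ : Space → ℝ}
    (hΦ : InnerProductSpace.HarmonicOnNhd Φ Ω) {x : Space} (hx : x ∈ Ω) :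
    ∑ i, fderivWithin ℝ (fun y => fderivWithin ℝ Φ (closure Ω) y
      (EuclideanSpace.basisFun (Fin 3) ℝ i)) (closure Ω) x
        (EuclideanSpace.basisFun (Fin 3) ℝ i) = 0 := by
  have h := (hΦ x hx).2.self_of_nhds
  rw [InnerProductSpace.laplacian_eq_iteratedFDeriv_orthonormalBasis Φ
    (EuclideanSpace.basisFun (Fin 3) ℝ)] at h
  simp only [Pi.zero_apply] at h
  rw [← h]
  refine Finset.sum_congr rfl fun i _ => ?_
  rw [fderivWithin_closure_eq hΩ _ hx, iteratedFDeriv_two_apply]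
  set b := EuclideanSpace.basisFun (Fin 3) ℝ i
  have hev : (fun y => fderivWithin ℝ Φ (closure Ω) y b) =ᶠ[𝓝 x] fun y => fderiv ℝ Φ y b := by
    filter_upwards [hΩ.mem_nhds hx] with y hy
    rw [fderivWithin_closure_eq hΩ Φ hy]
  have hd : DifferentiableAt ℝ (fderiv ℝ Φ) x :=
    ((hΦ x hx).1.fderiv_right (m := 1) (by norm_num)).differentiableAt one_ne_zero
  rw [hev.fderiv_eq, fderiv_clm_apply hd (differentiableAt_const b)]
  simp

namespace IsSmoothDomain

variable {Ω : Set Space}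

/-- Green's first identity, tested against a function with compact support. -/
theorem integral_inner_gradientWithin (hΩ : IsSmoothDomain Ω) {K : Set Space} (hK : IsCompact K)
    {A Φ : Space → ℝ} (hA : ContDiffOn ℝ 1 A (closure Ω)) (h0 : ∀ x ∈ closure Ω \ K, A x = 0)
    (hΦ : ContDiffOn ℝ ∞ Φ (closure Ω)) (hharm : InnerProductSpace.HarmonicOnNhd Φ Ω) :
    ∫ x in Ω, ⟪gradientWithin A (closure Ω) x, gradientWithin Φ (closure Ω) x⟫ =
      ∫ x in frontier Ω, A x * fderivWithin ℝ Φ (closure Ω) x (outwardNormal Ω x) ∂area := by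
  set b := EuclideanSpace.basisFun (Fin 3) ℝ with hb
  have hU := hΩ.uniqueDiffOn_closure
  have hDΦ : ∀ i, ContDiffOn ℝ 1 (fun y => fderivWithin ℝ Φ (closure Ω) y (b i)) (closure Ω) :=
    fun i => (hΦ.fderivWithin hU (m := 1) (by norm_cast)).clm_apply contDiffOn_const
  have hf : ∀ i, ContDiffOn ℝ 1 (fun y => A y * fderivWithin ℝ Φ (closure Ω) y (b i))
      (closure Ω) := fun i => hA.mul (hDΦ i)
  have hf0 : ∀ i, ∀ x ∈ closure Ω \ K, A x * fderivWithin ℝ Φ (closure Ω) x (b i) = 0 :=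
    fun i x hx => by rw [h0 x hx, zero_mul]
  have hfc : frontier Ω ⊆ closure Ω := frontier_subset_closure
  have e₁ : ∫ x in Ω, ⟪gradientWithin A (closure Ω) x, gradientWithin Φ (closure Ω) x⟫ =
      ∑ i, ∫ x in Ω, fderivWithin ℝ (fun y => A y * fderivWithin ℝ Φ (closure Ω) y (b i))
        (closure Ω) x (b i) := by
    rw [← integral_finsetSum _ fun i _ => hΩ.integrableOn_fderivWithin (hf i) hK (hf0 i) (b i)]
    refine setIntegral_congr_fun hΩ.1.measurableSet fun x hx => ?_
    have hx' := subset_closure hx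
    have hprod : ∀ i, fderivWithin ℝ (fun y => A y * fderivWithin ℝ Φ (closure Ω) y (b i))
        (closure Ω) x (b i) =
        A x * fderivWithin ℝ (fun y => fderivWithin ℝ Φ (closure Ω) y (b i)) (closure Ω) x (b i) +
        ⟪gradientWithin A (closure Ω) x, b i⟫ * ⟪b i, gradientWithin Φ (closure Ω) x⟫ := by
      intro i
      rw [fderivWithin_fun_mul (hU x hx') (hA.differentiableOn one_ne_zero x hx')
        ((hDΦ i).differentiableOn one_ne_zero x hx'), real_inner_comm _ (b i),
        inner_gradientWithin_left, inner_gradientWithin_left]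
      simp [mul_comm]
    simp only [hprod]
    rw [Finset.sum_add_distrib, ← Finset.mul_sum, hb,
      sum_fderivWithin_fderivWithin_eq_zero hΩ.1 hharm hx, mul_zero, zero_add,
      OrthonormalBasis.sum_inner_mul_inner]
  have e₂ : ∫ x in frontier Ω, A x * fderivWithin ℝ Φ (closure Ω) x (outwardNormal Ω x) ∂area =
      ∑ i, ∫ x in frontier Ω, A x * fderivWithin ℝ Φ (closure Ω) x (b i) *
        ⟪outwardNormal Ω x, b i⟫ ∂area := by
    rw [← integral_finsetSum _ fun i _ => hΩ.integrableOn_frontier hK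
      (φ := fun x => A x * fderivWithin ℝ Φ (closure Ω) x (b i) * ⟪outwardNormal Ω x, b i⟫)
      (((hf i).continuousOn.mono hfc).mul
        (hΩ.continuousOn_outwardNormal.inner continuousOn_const))
      (fun x hx => by rw [hf0 i x ⟨hfc hx.1, hx.2⟩, zero_mul])]
    refine setIntegral_congr_fun isClosed_frontier.measurableSet fun x hx => ?_
    simp_rw [mul_assoc]
    rw [← Finset.mul_sum]
    congr 1
    rw [← inner_gradientWithin_left, ← OrthonormalBasis.sum_inner_mul_inner b]
    refine Finset.sum_congr rfl fun i _ => ?_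
    rw [inner_gradientWithin_left, real_inner_comm]
  rw [e₁, e₂]
  exact Finset.sum_congr rfl fun i _ => hΩ.setIntegral_fderivWithin hK (hf i) (hf0 i) (b i)

end IsSmoothDomain

/-! ### Truncation of functions that vanish at infinity -/

theorem deriv_smoothTransition_of_one_lt {t : ℝ} (ht : 1 < t) :
    deriv Real.smoothTransition t = 0 := by
  have : Real.smoothTransition =ᶠ[𝓝 t] fun _ => 1 := by
    filter_upwards [lt_mem_nhds ht] with s hs using Real.smoothTransition.one_of_one_le hs.le
  rw [this.deriv_eq, deriv_const]

theorem exists_bound_mul_deriv_smoothTransition :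
    ∃ C : ℝ, ∀ t, 0 ≤ t → t * deriv Real.smoothTransition (t - 1) ≤ C := by
  have hc : Continuous fun t => t * deriv Real.smoothTransition (t - 1) :=
    continuous_id.mul (((Real.smoothTransition.contDiff (n := 1)).continuous_deriv le_rfl).comp
      (continuous_id.sub continuous_const))
  obtain ⟨C, hC⟩ := (isCompact_Icc (a := (0 : ℝ)) (b := 2)).exists_bound_of_continuousOn
    hc.continuousOn
  refine ⟨max C 0, fun t ht => ?_⟩
  rcases le_or_gt t 2 with h | h
  · exact (le_abs_self _).trans ((hC t ⟨ht, h⟩).trans (le_max_left _ _))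
  · rw [deriv_smoothTransition_of_one_lt (by linarith), mul_zero]
    exact le_max_right _ _

/-- `Φ` is harmonic in `Ω`, smooth up to the boundary, and tends to `0` at infinity in `Ω`. -/
structure IsDecayingHarmonic (Ω : Set Space) (Φ : Space → ℝ) : Prop where
  smooth : ContDiffOn ℝ ∞ Φ (closure Ω)
  harmonic : InnerProductSpace.HarmonicOnNhd Φ Ω
  decay : Tendsto Φ (cocompact Space ⊓ 𝓟 (closure Ω)) (𝓝 0)

/-- The cutoff that vanishes where `Φ₁² + Φ₂² ≤ 1 / k` and equals `1` where
`Φ₁² + Φ₂² ≥ 2 / k`. -/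
noncomputable def levelCutoff (Φ₁ Φ₂ : Space → ℝ) (k : ℕ) (x : Space) : ℝ :=
  Real.smoothTransition (k * (Φ₁ x ^ 2 + Φ₂ x ^ 2) - 1)

/-- The derivative of the cutoff with respect to `Φ₁² + Φ₂²`. -/
noncomputable def levelCutoffSlope (Φ₁ Φ₂ : Space → ℝ) (k : ℕ) (x : Space) : ℝ :=
  k * deriv Real.smoothTransition (k * (Φ₁ x ^ 2 + Φ₂ x ^ 2) - 1)

section Truncation

variable {Ω : Set Space} {Φ₁ Φ₂ : Space → ℝ}

theorem levelCutoff_nonneg (k : ℕ) (x : Space) : 0 ≤ levelCutoff Φ₁ Φ₂ k x :=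
  Real.smoothTransition.nonneg _

theorem levelCutoff_le_one (k : ℕ) (x : Space) : levelCutoff Φ₁ Φ₂ k x ≤ 1 :=
  Real.smoothTransition.le_one _

theorem levelCutoffSlope_nonneg (k : ℕ) (x : Space) : 0 ≤ levelCutoffSlope Φ₁ Φ₂ k x :=
  mul_nonneg (Nat.cast_nonneg k) Real.smoothTransition.monotone.deriv_nonneg

theorem levelCutoff_eq_zero (k : ℕ) {x : Space} (h : Φ₁ x ^ 2 + Φ₂ x ^ 2 = 0) :
    levelCutoff Φ₁ Φ₂ k x = 0 := by
  rw [levelCutoff, h]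
  exact Real.smoothTransition.zero_of_nonpos (by simp)

theorem eventually_lt_natCast_mul {q : ℝ} (hq : 0 < q) : ∀ᶠ k : ℕ in atTop, 2 < k * q := by
  have : Tendsto (fun k : ℕ => (k : ℝ) * q) atTop atTop :=
    tendsto_natCast_atTop_atTop.atTop_mul_const hq
  exact this.eventually_gt_atTop 2

theorem eventually_levelCutoff_eq_one {x : Space} (h : 0 < Φ₁ x ^ 2 + Φ₂ x ^ 2) :
    ∀ᶠ k : ℕ in atTop, levelCutoff Φ₁ Φ₂ k x = 1 := by
  filter_upwards [eventually_lt_natCast_mul h] with k hk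
  exact Real.smoothTransition.one_of_one_le (by linarith)

theorem eventually_levelCutoffSlope_eq_zero {x : Space} (h : 0 < Φ₁ x ^ 2 + Φ₂ x ^ 2) :
    ∀ᶠ k : ℕ in atTop, levelCutoffSlope Φ₁ Φ₂ k x = 0 := by
  filter_upwards [eventually_lt_natCast_mul h] with k hk
  rw [levelCutoffSlope, deriv_smoothTransition_of_one_lt (by linarith), mul_zero]

theorem contDiffOn_levelCutoff (h₁ : ContDiffOn ℝ ∞ Φ₁ (closure Ω))
    (h₂ : ContDiffOn ℝ ∞ Φ₂ (closure Ω)) (k : ℕ) :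
    ContDiffOn ℝ 1 (levelCutoff Φ₁ Φ₂ k) (closure Ω) := by
  have hs₁ : ContDiffOn ℝ 1 Φ₁ (closure Ω) := h₁.of_le (by norm_cast)
  have hs₂ : ContDiffOn ℝ 1 Φ₂ (closure Ω) := h₂.of_le (by norm_cast)
  exact Real.smoothTransition.contDiff.comp_contDiffOn
    ((contDiffOn_const.mul ((hs₁.pow 2).add (hs₂.pow 2))).sub contDiffOn_const)

/-- The cutoff has compact support because the two functions tend to `0` at infinity. -/
theorem exists_isCompact_levelCutoff_eq_zero (h₁ : IsDecayingHarmonic Ω Φ₁)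
    (h₂ : IsDecayingHarmonic Ω Φ₂) (k : ℕ) :
    ∃ K, IsCompact K ∧ ∀ x ∈ closure Ω \ K, levelCutoff Φ₁ Φ₂ k x = 0 := by
  have hlim : Tendsto (fun x => (k : ℝ) * (Φ₁ x ^ 2 + Φ₂ x ^ 2))
      (cocompact Space ⊓ 𝓟 (closure Ω)) (𝓝 0) := by
    have := ((h₁.decay.pow 2).add (h₂.decay.pow 2)).const_mul (k : ℝ)
    simpa using this
  have hev := hlim.eventually (gt_mem_nhds one_pos)
  rw [eventually_inf_principal] at hev
  obtain ⟨K, hK, hsub⟩ := mem_cocompact.1 hev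
  refine ⟨K, hK, fun x hx => ?_⟩
  have : (k : ℝ) * (Φ₁ x ^ 2 + Φ₂ x ^ 2) < 1 := hsub hx.2 hx.1
  exact Real.smoothTransition.zero_of_nonpos (by linarith)

theorem gradientWithin_levelCutoff_mul (hΩ : IsSmoothDomain Ω)
    (h₁ : ContDiffOn ℝ ∞ Φ₁ (closure Ω)) (h₂ : ContDiffOn ℝ ∞ Φ₂ (closure Ω)) {φ : Space → ℝ}
    (hφ : ContDiffOn ℝ ∞ φ (closure Ω)) (k : ℕ) {x : Space} (hx : x ∈ closure Ω) :
    gradientWithin (fun y => levelCutoff Φ₁ Φ₂ k y * φ y) (closure Ω) x =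
      levelCutoff Φ₁ Φ₂ k x • gradientWithin φ (closure Ω) x +
      (2 * levelCutoffSlope Φ₁ Φ₂ k x * φ x) •
        (Φ₁ x • gradientWithin Φ₁ (closure Ω) x + Φ₂ x • gradientWithin Φ₂ (closure Ω) x) := by
  have hd : ∀ {f : Space → ℝ}, ContDiffOn ℝ ∞ f (closure Ω) →
      HasFDerivWithinAt f (fderivWithin ℝ f (closure Ω) x) (closure Ω) x := fun hf =>
    (hf.differentiableOn (by simp) x hx).hasFDerivWithinAt
  have hQ := ((((hd h₁).pow 2).add ((hd h₂).pow 2)).const_mul (k : ℝ)).sub_const 1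
  have hst : HasDerivAt Real.smoothTransition
      (deriv Real.smoothTransition (k * (Φ₁ x ^ 2 + Φ₂ x ^ 2) - 1))
      ((k : ℝ) * (Φ₁ x ^ 2 + Φ₂ x ^ 2) - 1) :=
    ((Real.smoothTransition.contDiff (n := 1)).differentiable one_ne_zero _).hasDerivAt
  have hc := hst.comp_hasFDerivWithinAt x hQ
  have hm := (hc.mul (hd hφ)).fderivWithin (hΩ.uniqueDiffOn_closure x hx)
  refine ext_inner_right ℝ fun v => ?_
  rw [inner_gradientWithin_left]
  have hm' : fderivWithin ℝ (fun y => levelCutoff Φ₁ Φ₂ k y * φ y) (closure Ω) x = _ := hm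
  rw [hm']
  simp only [inner_add_left, real_inner_smul_left, inner_gradientWithin_left, levelCutoff,
    levelCutoffSlope, Function.comp_apply, add_apply,
    smul_apply, smul_eq_mul, Pi.add_apply]
  push_cast
  ring

end Truncation

/-- A pointwise limit of nonnegative functions with bounded integrals is integrable. -/
theorem integrable_of_tendsto_of_integral_le {α : Type*} [MeasurableSpace α] {μ : Measure α}
    {u : ℕ → α → ℝ} {v : α → ℝ} {C : ℝ} (hu : ∀ k, Integrable (u k) μ)
    (hu0 : ∀ k x, 0 ≤ u k x) (hC : ∀ k, ∫ x, u k x ∂μ ≤ C)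
    (hlim : ∀ᵐ x ∂μ, Tendsto (fun k => u k x) atTop (𝓝 (v x))) : Integrable v μ := by
  refine ⟨aestronglyMeasurable_of_tendsto_ae atTop (fun k => (hu k).aestronglyMeasurable) hlim, ?_⟩
  have h1 : ∫⁻ x, ‖v x‖ₑ ∂μ = ∫⁻ x, liminf (fun k => ‖u k x‖ₑ) atTop ∂μ := by
    refine lintegral_congr_ae (hlim.mono fun x hx => ?_)
    exact ((continuous_enorm.tendsto _).comp hx).liminf_eq.symm
  rw [HasFiniteIntegral, h1]
  refine (lintegral_liminf_le' fun k => (hu k).aestronglyMeasurable.enorm).trans_lt ?_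
  have h2 : ∀ k, ∫⁻ x, ‖u k x‖ₑ ∂μ ≤ ENNReal.ofReal C := by
    intro k
    rw [← ofReal_integral_norm_eq_lintegral_enorm (hu k)]
    refine ENNReal.ofReal_le_ofReal (le_of_eq_of_le ?_ (hC k))
    exact integral_congr_ae (ae_of_all _ fun x => Real.norm_of_nonneg (hu0 k x))
  refine lt_of_le_of_lt ?_ (ENNReal.ofReal_lt_top (r := C))
  exact liminf_le_of_le (by isBoundedDefault) fun b hb => by
    obtain ⟨k, hk⟩ := hb.exists
    exact hk.trans (h2 k)

/-! ### Green's second identity in an unbounded domain -/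

section Green

variable {Ω K : Set Space} {Φ₁ Φ₂ : Space → ℝ}

/-- The energy density of a pair of functions. -/
noncomputable def energyDensity (Ω : Set Space) (Φ₁ Φ₂ : Space → ℝ) (x : Space) : ℝ :=
  ‖gradientWithin Φ₁ (closure Ω) x‖ ^ 2 + ‖gradientWithin Φ₂ (closure Ω) x‖ ^ 2

theorem energyDensity_nonneg (x : Space) : 0 ≤ energyDensity Ω Φ₁ Φ₂ x := by
  unfold energyDensity; positivity

theorem IsSmoothDomain.continuousOn_gradientWithin (hΩ : IsSmoothDomain Ω) {Φ : Space → ℝ}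
    (hΦ : ContDiffOn ℝ 1 Φ (closure Ω)) :
    ContinuousOn (gradientWithin Φ (closure Ω)) (closure Ω) :=
  (InnerProductSpace.toDual ℝ Space).symm.continuous.comp_continuousOn
    (hΦ.continuousOn_fderivWithin hΩ.uniqueDiffOn_closure le_rfl)

theorem IsSmoothDomain.integrableOn_inner_gradientWithin (hΩ : IsSmoothDomain Ω)
    (hK : IsCompact K) {A Φ : Space → ℝ} (hA : ContDiffOn ℝ 1 A (closure Ω))
    (hA0 : ∀ x ∈ closure Ω \ K, A x = 0) (hΦ : ContDiffOn ℝ 1 Φ (closure Ω)) :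
    IntegrableOn (fun x => ⟪gradientWithin A (closure Ω) x, gradientWithin Φ (closure Ω) x⟫) Ω := by
  refine integrableOn_of_zero_off_compact_volume hΩ.1
    ((hΩ.continuousOn_gradientWithin hA).inner (hΩ.continuousOn_gradientWithin hΦ)) hK
    fun x hx => ?_
  rw [inner_gradientWithin_left, fderivWithin_zero_off_compact hK hA0 hx]
  rfl

theorem IsSmoothDomain.continuousOn_fderivWithin_normal (hΩ : IsSmoothDomain Ω) {Φ : Space → ℝ}
    (hΦ : ContDiffOn ℝ ∞ Φ (closure Ω)) :
    ContinuousOn (fun x => fderivWithin ℝ Φ (closure Ω) x (outwardNormal Ω x)) (frontier Ω) :=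
  ((hΦ.continuousOn_fderivWithin hΩ.uniqueDiffOn_closure (by simp)).mono
    frontier_subset_closure).clm_apply hΩ.continuousOn_outwardNormal

theorem IsSmoothDomain.integrableOn_mul_fderivWithin_normal (hΩ : IsSmoothDomain Ω)
    (hK : IsCompact K) {A Φ : Space → ℝ} (hA : ContinuousOn A (frontier Ω))
    (hA0 : ∀ x ∈ frontier Ω \ K, A x = 0) (hΦ : ContDiffOn ℝ ∞ Φ (closure Ω)) :
    IntegrableOn (fun x => A x * fderivWithin ℝ Φ (closure Ω) x (outwardNormal Ω x))
      (frontier Ω) area :=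
  hΩ.integrableOn_frontier hK (hA.mul (hΩ.continuousOn_fderivWithin_normal hΦ))
    fun x hx => by rw [hA0 x hx, zero_mul]

/-- Harmonic functions that tend to `0` at infinity and vanish on the far part of the boundary have
finite energy, at least off their common zero set. -/
theorem integrableOn_energyDensity (hΩ : IsSmoothDomain Ω) (h₁ : IsDecayingHarmonic Ω Φ₁)
    (h₂ : IsDecayingHarmonic Ω Φ₂) (hK : IsCompact K) (hK₁ : ∀ x ∈ frontier Ω \ K, Φ₁ x = 0)
    (hK₂ : ∀ x ∈ frontier Ω \ K, Φ₂ x = 0) :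
    IntegrableOn ({x | 0 < Φ₁ x ^ 2 + Φ₂ x ^ 2}.indicator (energyDensity Ω Φ₁ Φ₂)) Ω := by
  have hfc : frontier Ω ⊆ closure Ω := frontier_subset_closure
  have hs₁ : ContDiffOn ℝ 1 Φ₁ (closure Ω) := h₁.smooth.of_le (by norm_cast)
  have hs₂ : ContDiffOn ℝ 1 Φ₂ (closure Ω) := h₂.smooth.of_le (by norm_cast)
  have hg₁ := hΩ.continuousOn_gradientWithin hs₁
  have hg₂ := hΩ.continuousOn_gradientWithin hs₂
  set E := energyDensity Ω Φ₁ Φ₂ with hE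
  have hEc : ContinuousOn E (closure Ω) := (hg₁.norm.pow 2).add (hg₂.norm.pow 2)
  set c := levelCutoff Φ₁ Φ₂ with hc
  set T : Space → ℝ := fun x => Φ₁ x * fderivWithin ℝ Φ₁ (closure Ω) x (outwardNormal Ω x) +
    Φ₂ x * fderivWithin ℝ Φ₂ (closure Ω) x (outwardNormal Ω x) with hT
  have hTint : IntegrableOn T (frontier Ω) area :=
    (hΩ.integrableOn_mul_fderivWithin_normal hK (hs₁.continuousOn.mono hfc) hK₁ h₁.smooth).add
      (hΩ.integrableOn_mul_fderivWithin_normal hK (hs₂.continuousOn.mono hfc) hK₂ h₂.smooth)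
  have hcE : ∀ k, IntegrableOn (fun x => c k x * E x) Ω := by
    intro k
    obtain ⟨L, hL, hL0⟩ := exists_isCompact_levelCutoff_eq_zero h₁ h₂ k
    exact integrableOn_of_zero_off_compact_volume hΩ.1
      ((contDiffOn_levelCutoff h₁.smooth h₂.smooth k).continuousOn.mul hEc) hL
      (fun x hx => by simp only [hc, hL0 x hx, zero_mul])
  refine integrable_of_tendsto_of_integral_le (u := fun k x => c k x * E x)
    (C := ∫ x in frontier Ω, |T x| ∂area) hcE
    (fun k x => mul_nonneg (levelCutoff_nonneg k x) (energyDensity_nonneg x)) (fun k => ?_) ?_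
  · obtain ⟨L, hL, hL0⟩ := exists_isCompact_levelCutoff_eq_zero h₁ h₂ k
    have hck := contDiffOn_levelCutoff h₁.smooth h₂.smooth k
    have hcΦ₁ : ContDiffOn ℝ 1 (fun x => c k x * Φ₁ x) (closure Ω) := hck.mul hs₁
    have hcΦ₂ : ContDiffOn ℝ 1 (fun x => c k x * Φ₂ x) (closure Ω) := hck.mul hs₂
    have z₁ : ∀ x ∈ closure Ω \ L, c k x * Φ₁ x = 0 := fun x hx => by
      simp only [hc, hL0 x hx, zero_mul]
    have z₂ : ∀ x ∈ closure Ω \ L, c k x * Φ₂ x = 0 := fun x hx => by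
      simp only [hc, hL0 x hx, zero_mul]
    have g₁ := hΩ.integral_inner_gradientWithin hL hcΦ₁ z₁ h₁.smooth h₁.harmonic
    have g₂ := hΩ.integral_inner_gradientWithin hL hcΦ₂ z₂ h₂.smooth h₂.harmonic
    have i₁ := hΩ.integrableOn_inner_gradientWithin hL hcΦ₁ z₁ hs₁
    have i₂ := hΩ.integrableOn_inner_gradientWithin hL hcΦ₂ z₂ hs₂
    have hle : ∫ x in Ω, c k x * E x ≤
        ∫ x in Ω, (⟪gradientWithin (fun x => c k x * Φ₁ x) (closure Ω) x,
            gradientWithin Φ₁ (closure Ω) x⟫ +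
          ⟪gradientWithin (fun x => c k x * Φ₂ x) (closure Ω) x,
            gradientWithin Φ₂ (closure Ω) x⟫) := by
      refine setIntegral_mono_on (hcE k) (i₁.add i₂)
        hΩ.1.measurableSet fun x hx => ?_
      have hx' := subset_closure hx
      rw [hc, gradientWithin_levelCutoff_mul hΩ h₁.smooth h₂.smooth h₁.smooth k hx',
        gradientWithin_levelCutoff_mul hΩ h₁.smooth h₂.smooth h₂.smooth k hx', hE,
        energyDensity]
      set G₁ := gradientWithin Φ₁ (closure Ω) x
      set G₂ := gradientWithin Φ₂ (closure Ω) x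
      set d := levelCutoffSlope Φ₁ Φ₂ k x
      have hd : 0 ≤ d := levelCutoffSlope_nonneg k x
      have key : ⟪levelCutoff Φ₁ Φ₂ k x • G₁ + (2 * d * Φ₁ x) • (Φ₁ x • G₁ + Φ₂ x • G₂), G₁⟫ +
          ⟪levelCutoff Φ₁ Φ₂ k x • G₂ + (2 * d * Φ₂ x) • (Φ₁ x • G₁ + Φ₂ x • G₂), G₂⟫ =
          levelCutoff Φ₁ Φ₂ k x * (‖G₁‖ ^ 2 + ‖G₂‖ ^ 2) +
            2 * d * ⟪Φ₁ x • G₁ + Φ₂ x • G₂, Φ₁ x • G₁ + Φ₂ x • G₂⟫ := by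
        simp only [inner_add_left, inner_add_right, real_inner_smul_left, real_inner_smul_right,
          ← real_inner_self_eq_norm_sq, real_inner_comm G₁ G₂]
        ring
      rw [key]
      have : 0 ≤ ⟪Φ₁ x • G₁ + Φ₂ x • G₂, Φ₁ x • G₁ + Φ₂ x • G₂⟫ := real_inner_self_nonneg
      nlinarith [mul_nonneg hd this]
    refine hle.trans ?_
    have hb₁ := hΩ.integrableOn_mul_fderivWithin_normal hK (hcΦ₁.continuousOn.mono hfc)
      (fun x hx => by simp only [hK₁ x hx, mul_zero]) h₁.smooth
    have hb₂ := hΩ.integrableOn_mul_fderivWithin_normal hK (hcΦ₂.continuousOn.mono hfc)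
      (fun x hx => by simp only [hK₂ x hx, mul_zero]) h₂.smooth
    rw [integral_add i₁ i₂, g₁, g₂, ← integral_add hb₁ hb₂]
    refine integral_mono (hb₁.add hb₂) hTint.abs fun x => ?_
    have hfac : c k x * Φ₁ x * fderivWithin ℝ Φ₁ (closure Ω) x (outwardNormal Ω x) +
        c k x * Φ₂ x * fderivWithin ℝ Φ₂ (closure Ω) x (outwardNormal Ω x) = c k x * T x := by
      simp only [hT]; ring
    simp only [hfac]
    calc c k x * T x ≤ c k x * |T x| :=
          mul_le_mul_of_nonneg_left (le_abs_self _) (levelCutoff_nonneg k x)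
      _ ≤ |T x| := mul_le_of_le_one_left (abs_nonneg _) (levelCutoff_le_one k x)
  · refine (ae_restrict_iff' hΩ.1.measurableSet).2 (ae_of_all _ fun x hx => ?_)
    rcases (add_nonneg (sq_nonneg (Φ₁ x)) (sq_nonneg (Φ₂ x))).eq_or_lt with h0 | h0
    · have h1 : x ∉ {x | 0 < Φ₁ x ^ 2 + Φ₂ x ^ 2} := fun h => h0.not_lt h
      rw [indicator_of_notMem h1]
      simp only [hc, levelCutoff_eq_zero _ h0.symm, zero_mul]
      exact tendsto_const_nhds
    · rw [indicator_of_mem (show x ∈ {x | 0 < Φ₁ x ^ 2 + Φ₂ x ^ 2} from h0)]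
      refine tendsto_const_nhds.congr' ?_
      filter_upwards [eventually_levelCutoff_eq_one h0] with k hk
      simp only [hc, hk, one_mul]

/-- Green's second identity for harmonic functions that tend to `0` at infinity and vanish on the
far part of the boundary. No rate of decay is needed: truncating at the level sets of
`Φ₁² + Φ₂²` instead of at large spheres makes the test functions compactly supported, and the
error is controlled by the energy in the thin layer between two level sets. -/
theorem IsSmoothDomain.integral_mul_normalDeriv_comm (hΩ : IsSmoothDomain Ω)
    (h₁ : IsDecayingHarmonic Ω Φ₁) (h₂ : IsDecayingHarmonic Ω Φ₂) (hK : IsCompact K)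
    (hK₁ : ∀ x ∈ frontier Ω \ K, Φ₁ x = 0) (hK₂ : ∀ x ∈ frontier Ω \ K, Φ₂ x = 0) :
    ∫ x in frontier Ω, Φ₁ x * fderivWithin ℝ Φ₂ (closure Ω) x (outwardNormal Ω x) ∂area =
      ∫ x in frontier Ω, Φ₂ x * fderivWithin ℝ Φ₁ (closure Ω) x (outwardNormal Ω x) ∂area := by
  have hfc : frontier Ω ⊆ closure Ω := frontier_subset_closure
  have hs₁ : ContDiffOn ℝ 1 Φ₁ (closure Ω) := h₁.smooth.of_le (by norm_cast)
  have hs₂ : ContDiffOn ℝ 1 Φ₂ (closure Ω) := h₂.smooth.of_le (by norm_cast)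
  set c := levelCutoff Φ₁ Φ₂ with hc
  set P : Set Space := {x | 0 < Φ₁ x ^ 2 + Φ₂ x ^ 2} with hP
  have hEint := integrableOn_energyDensity hΩ h₁ h₂ hK hK₁ hK₂
  have ht₁ := hΩ.integrableOn_mul_fderivWithin_normal hK (hs₁.continuousOn.mono hfc) hK₁ h₂.smooth
  have ht₂ := hΩ.integrableOn_mul_fderivWithin_normal hK (hs₂.continuousOn.mono hfc) hK₂ h₁.smooth
  set T : Space → ℝ := fun x => Φ₁ x * fderivWithin ℝ Φ₂ (closure Ω) x (outwardNormal Ω x) -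
    Φ₂ x * fderivWithin ℝ Φ₁ (closure Ω) x (outwardNormal Ω x) with hT
  have hTint : IntegrableOn T (frontier Ω) area := ht₁.sub ht₂
  -- the error term, supported between two level sets
  set I : ℕ → Space → ℝ := fun k x => 2 * levelCutoffSlope Φ₁ Φ₂ k x *
    ⟪Φ₁ x • gradientWithin Φ₁ (closure Ω) x + Φ₂ x • gradientWithin Φ₂ (closure Ω) x,
      Φ₁ x • gradientWithin Φ₂ (closure Ω) x - Φ₂ x • gradientWithin Φ₁ (closure Ω) x⟫ with hI
  have hgreen : ∀ k, IntegrableOn (I k) Ω ∧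
      ∫ x in Ω, I k x = ∫ x in frontier Ω, c k x * T x ∂area := by
    intro k
    obtain ⟨L, hL, hL0⟩ := exists_isCompact_levelCutoff_eq_zero h₁ h₂ k
    have hck := contDiffOn_levelCutoff h₁.smooth h₂.smooth k
    have hcΦ₁ : ContDiffOn ℝ 1 (fun x => c k x * Φ₁ x) (closure Ω) := hck.mul hs₁
    have hcΦ₂ : ContDiffOn ℝ 1 (fun x => c k x * Φ₂ x) (closure Ω) := hck.mul hs₂
    have z₁ : ∀ x ∈ closure Ω \ L, c k x * Φ₁ x = 0 := fun x hx => by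
      simp only [hc, hL0 x hx, zero_mul]
    have z₂ : ∀ x ∈ closure Ω \ L, c k x * Φ₂ x = 0 := fun x hx => by
      simp only [hc, hL0 x hx, zero_mul]
    have g₁ := hΩ.integral_inner_gradientWithin hL hcΦ₁ z₁ h₂.smooth h₂.harmonic
    have g₂ := hΩ.integral_inner_gradientWithin hL hcΦ₂ z₂ h₁.smooth h₁.harmonic
    have i₁ := hΩ.integrableOn_inner_gradientWithin hL hcΦ₁ z₁ hs₂
    have i₂ := hΩ.integrableOn_inner_gradientWithin hL hcΦ₂ z₂ hs₁
    have hb₁ := hΩ.integrableOn_mul_fderivWithin_normal hK (hcΦ₁.continuousOn.mono hfc)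
      (fun x hx => by simp only [hK₁ x hx, mul_zero]) h₂.smooth
    have hb₂ := hΩ.integrableOn_mul_fderivWithin_normal hK (hcΦ₂.continuousOn.mono hfc)
      (fun x hx => by simp only [hK₂ x hx, mul_zero]) h₁.smooth
    have hpt : EqOn (fun x => ⟪gradientWithin (fun x => c k x * Φ₁ x) (closure Ω) x,
          gradientWithin Φ₂ (closure Ω) x⟫ -
        ⟪gradientWithin (fun x => c k x * Φ₂ x) (closure Ω) x,
          gradientWithin Φ₁ (closure Ω) x⟫) (I k) Ω := by
      intro x hx
      have hx' := subset_closure hx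
      simp only [hI, hc]
      rw [gradientWithin_levelCutoff_mul hΩ h₁.smooth h₂.smooth h₁.smooth k hx',
        gradientWithin_levelCutoff_mul hΩ h₁.smooth h₂.smooth h₂.smooth k hx']
      simp only [inner_add_left, inner_sub_right, real_inner_smul_left, real_inner_smul_right,
        real_inner_comm (gradientWithin Φ₁ (closure Ω) x) (gradientWithin Φ₂ (closure Ω) x)]
      ring
    refine ⟨(i₁.sub i₂).congr_fun hpt hΩ.1.measurableSet, ?_⟩
    rw [← setIntegral_congr_fun hΩ.1.measurableSet hpt, integral_sub i₁ i₂, g₁, g₂,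
      ← integral_sub hb₁ hb₂]
    refine integral_congr_ae (ae_of_all _ fun x => ?_)
    simp only [hT]
    ring
  have hlimI : Tendsto (fun k => ∫ x in Ω, I k x) atTop (𝓝 (∫ x in Ω, (0 : ℝ))) := by
    obtain ⟨C, hC⟩ := exists_bound_mul_deriv_smoothTransition
    refine tendsto_integral_of_dominated_convergence
      (fun x => C * P.indicator (energyDensity Ω Φ₁ Φ₂) x)
      (fun k => (hgreen k).1.aestronglyMeasurable) (hEint.const_mul C) (fun k => ?_) ?_
    · refine ae_of_all _ fun x => ?_
      set G₁ := gradientWithin Φ₁ (closure Ω) x with hG₁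
      set G₂ := gradientWithin Φ₂ (closure Ω) x with hG₂
      set q := Φ₁ x ^ 2 + Φ₂ x ^ 2 with hq
      set u := Φ₁ x • G₁ + Φ₂ x • G₂ with hu
      set v := Φ₁ x • G₂ - Φ₂ x • G₁ with hv
      have hq0 : 0 ≤ q := by positivity
      have hd : 0 ≤ levelCutoffSlope Φ₁ Φ₂ k x := levelCutoffSlope_nonneg k x
      -- Lagrange's identity
      have hlag : ‖u‖ ^ 2 + ‖v‖ ^ 2 = q * energyDensity Ω Φ₁ Φ₂ x := by
        simp only [energyDensity, ← hG₁, ← hG₂, ← real_inner_self_eq_norm_sq, hu, hv, hq,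
          inner_add_left, inner_add_right, inner_sub_left, inner_sub_right, real_inner_smul_left,
          real_inner_smul_right, real_inner_comm G₁ G₂]
        ring
      have huv : 2 * |⟪u, v⟫| ≤ q * energyDensity Ω Φ₁ Φ₂ x := by
        rw [← hlag]
        nlinarith [abs_real_inner_le_norm u v, sq_nonneg (‖u‖ - ‖v‖)]
      have hbound : ‖I k x‖ ≤ levelCutoffSlope Φ₁ Φ₂ k x * (q * energyDensity Ω Φ₁ Φ₂ x) := by
        have : I k x = levelCutoffSlope Φ₁ Φ₂ k x * (2 * ⟪u, v⟫) := by
          simp only [hI, hu, hv, hG₁, hG₂]; ring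
        rw [this, norm_mul, Real.norm_of_nonneg hd, Real.norm_eq_abs, abs_mul, abs_two]
        exact mul_le_mul_of_nonneg_left huv hd
      refine hbound.trans ?_
      rcases hq0.eq_or_lt with h0 | h0
      · have h1 : x ∉ P := fun h => (show 0 < q from h).ne h0
        rw [indicator_of_notMem h1, ← h0]
        simp
      · rw [indicator_of_mem (show x ∈ P from h0), ← mul_assoc]
        refine mul_le_mul_of_nonneg_right ?_ (energyDensity_nonneg x)
        have := hC (k * q) (by positivity)
        rw [levelCutoffSlope]
        linarith
    · refine ae_of_all _ fun x => ?_
      rcases (add_nonneg (sq_nonneg (Φ₁ x)) (sq_nonneg (Φ₂ x))).eq_or_lt with h0 | h0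
      · have e₁ : Φ₁ x = 0 := by nlinarith [sq_nonneg (Φ₁ x), sq_nonneg (Φ₂ x)]
        have e₂ : Φ₂ x = 0 := by nlinarith [sq_nonneg (Φ₁ x), sq_nonneg (Φ₂ x)]
        simp [hI, e₁, e₂]
      · refine tendsto_const_nhds.congr' ?_
        filter_upwards [eventually_levelCutoffSlope_eq_zero h0] with k hk
        simp only [hI, hk, mul_zero, zero_mul]
  have hlimT : Tendsto (fun k => ∫ x in frontier Ω, c k x * T x ∂area) atTop
      (𝓝 (∫ x in frontier Ω, T x ∂area)) := by
    refine tendsto_integral_of_dominated_convergence (fun x => |T x|) (fun k => ?_) hTint.abs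
      (fun k => ?_) ?_
    · exact (((contDiffOn_levelCutoff h₁.smooth h₂.smooth k).continuousOn.mono
        hfc).aestronglyMeasurable isClosed_frontier.measurableSet).mul hTint.aestronglyMeasurable
    · refine ae_of_all _ fun x => ?_
      rw [norm_mul, Real.norm_of_nonneg (levelCutoff_nonneg k x)]
      exact mul_le_of_le_one_left (norm_nonneg _) (levelCutoff_le_one k x)
    · refine ae_of_all _ fun x => ?_
      rcases (add_nonneg (sq_nonneg (Φ₁ x)) (sq_nonneg (Φ₂ x))).eq_or_lt with h0 | h0
      · have e₁ : Φ₁ x = 0 := by nlinarith [sq_nonneg (Φ₁ x), sq_nonneg (Φ₂ x)]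
        have e₂ : Φ₂ x = 0 := by nlinarith [sq_nonneg (Φ₁ x), sq_nonneg (Φ₂ x)]
        simp [hT, e₁, e₂]
      · refine tendsto_const_nhds.congr' ?_
        filter_upwards [eventually_levelCutoff_eq_one h0] with k hk
        simp only [hc, hk, one_mul]
  simp only [fun k => (hgreen k).2, integral_zero] at hlimI
  have hT0 := tendsto_nhds_unique hlimT hlimI
  rw [hT, integral_sub ht₁ ht₂] at hT0
  exact sub_eq_zero.1 hT0

end Green

/-! ### Rigid velocities and wrenches -/

theorem cross_apply (a b : Space) (i : Fin 3) :
    cross a b i = ![a 1 * b 2 - a 2 * b 1, a 2 * b 0 - a 0 * b 2, a 0 * b 1 - a 1 * b 0] i := by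
  rw [cross, _root_.cross_apply]

/-- The triple product identity `(Ω × l) · n = Ω · (l × n)`, one component at a time. -/
theorem inner_rigidVelocity_single (i : Idx) (l n : Space) :
    ⟪rigidVelocity (Pi.single i 1) l, n⟫ = wrench n l i := by
  rcases i with i | i <;> fin_cases i <;>
    simp [rigidVelocity, wrench, cross_apply, PiLp.inner_apply, Fin.sum_univ_three] <;> ring

theorem continuousOn_wrench {s : Set Space} {N : Space → Space} (hN : ContinuousOn N s) (i : Idx) :
    ContinuousOn (fun l => wrench (N l) l i) s := by
  have hc : ∀ j : Fin 3, ContinuousOn (fun l => N l j) s := fun j =>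
    (EuclideanSpace.proj (𝕜 := ℝ) j).continuous.comp_continuousOn hN
  have hl : ∀ j : Fin 3, ContinuousOn (fun l : Space => l j) s := fun j =>
    (EuclideanSpace.proj (𝕜 := ℝ) j).continuous.continuousOn
  rcases i with i | i
  · exact hc i
  · simp only [wrench, Sum.elim_inr, cross_apply]
    fin_cases i
    · exact ((hl 1).mul (hc 2)).sub ((hl 2).mul (hc 1))
    · exact ((hl 2).mul (hc 0)).sub ((hl 0).mul (hc 2))
    · exact ((hl 0).mul (hc 1)).sub ((hl 1).mul (hc 0))

theorem rigidVelocity_add (u v : Idx → ℝ) (l : Space) :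
    rigidVelocity (u + v) l = rigidVelocity u l + rigidVelocity v l := by
  ext i
  fin_cases i <;> simp [rigidVelocity, cross_apply] <;> ring

theorem rigidVelocity_smul (c : ℝ) (u : Idx → ℝ) (l : Space) :
    rigidVelocity (c • u) l = c • rigidVelocity u l := by
  ext i
  fin_cases i <;> simp [rigidVelocity, cross_apply] <;> ring

/-! ### The fluid domain -/

namespace IsConfiguration

variable {W B : Set Space} {k : Space} {η₀ : ℝ}

theorem frontier_body_subset (h : IsConfiguration W B k η₀) : frontier B ⊆ B :=
  h.body_compact.isClosed.frontier_subset

theorem frontier_surface_subset_compl (h : IsConfiguration W B k η₀) : frontier W ⊆ Bᶜ := by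
  intro p hp hpB
  rw [h.surface_smooth.1.frontier_eq] at hp
  exact hp.2 (h.body_submerged hpB)

theorem mem_fluid_iff_of_mem_body (h : IsConfiguration W B k η₀) {p : Space} (hp : p ∈ B) :
    ∀ᶠ x in 𝓝 p, (x ∈ W \ B ↔ x ∈ Bᶜ) := by
  filter_upwards [h.surface_smooth.1.mem_nhds (h.body_submerged hp)] with x hx
  exact ⟨fun hx' => hx'.2, fun hx' => ⟨hx, hx'⟩⟩

theorem closure_fluid_eventuallyEq (h : IsConfiguration W B k η₀) {p : Space} (hp : p ∈ B) :
    closure (W \ B) =ᶠ[𝓝 p] closure Bᶜ := by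
  filter_upwards [h.surface_smooth.1.mem_nhds (h.body_submerged hp)] with x hx
  refine propext ⟨fun hx' => closure_mono (fun y hy => hy.2) hx', fun hx' => ?_⟩
  exact h.surface_smooth.1.inter_closure ⟨hx, hx'⟩

theorem frontier_fluid (h : IsConfiguration W B k η₀) :
    frontier (W \ B) = frontier W ∪ frontier B := by
  have hW := h.surface_smooth.1
  have hB : IsClosed B := h.body_compact.isClosed
  have hD : IsOpen (W \ B) := hW.sdiff hB
  ext p
  rw [hD.frontier_eq, hW.frontier_eq, ← frontier_compl B, hB.isOpen_compl.frontier_eq]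
  constructor
  · rintro ⟨hcl, hp⟩
    by_cases hpW : p ∈ W
    · exact Or.inr ⟨closure_mono (fun y hy => hy.2) hcl, fun hpB => hp ⟨hpW, hpB⟩⟩
    · exact Or.inl ⟨closure_mono sdiff_subset hcl, hpW⟩
  · rintro (⟨hcl, hp⟩ | ⟨hcl, hp⟩)
    · refine ⟨?_, fun h' => hp h'.1⟩
      have hpB : p ∈ Bᶜ := fun hpB => hp (h.body_submerged hpB)
      have := hB.isOpen_compl.inter_closure ⟨hpB, hcl⟩
      rwa [inter_comm] at this
    · refine ⟨?_, fun h' => hp h'.2⟩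
      exact hW.inter_closure ⟨h.body_submerged (not_not.1 hp), hcl⟩

theorem isSmoothDomain_fluid (h : IsConfiguration W B k η₀) : IsSmoothDomain (W \ B) := by
  have hB : IsClosed B := h.body_compact.isClosed
  refine ⟨h.surface_smooth.1.sdiff hB, fun p hp => ?_⟩
  rw [h.frontier_fluid] at hp
  rcases hp with hp | hp
  · obtain ⟨r, h1, h2, h3, h4⟩ := h.surface_smooth.2 p hp
    refine ⟨r, h1, h2, h3, ?_⟩
    filter_upwards [h4, hB.isOpen_compl.mem_nhds (h.frontier_surface_subset_compl hp)]
      with x hx hxB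
    exact ⟨fun hx' => hx.1 hx'.1, fun hx' => ⟨hx.2 hx', hxB⟩⟩
  · obtain ⟨r, h1, h2, h3, h4⟩ := h.body_smooth.2 p (by rwa [frontier_compl])
    refine ⟨r, h1, h2, h3, ?_⟩
    filter_upwards [h4, h.mem_fluid_iff_of_mem_body (h.frontier_body_subset hp)] with x hx hx'
    exact hx'.trans hx

theorem bodyNormal_eq (h : IsConfiguration W B k η₀) {p : Space} (hp : p ∈ frontier B) :
    bodyNormal B p = -outwardNormal (W \ B) p := by
  rw [bodyNormal, outwardNormal_congr (h.mem_fluid_iff_of_mem_body (h.frontier_body_subset hp))]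

theorem frontier_body_subset_closure (h : IsConfiguration W B k η₀) :
    frontier B ⊆ closure (W \ B) := fun p hp =>
  frontier_subset_closure (by rw [h.frontier_fluid]; exact Or.inr hp)

theorem frontier_surface_subset_closure (h : IsConfiguration W B k η₀) :
    frontier W ⊆ closure (W \ B) := fun p hp =>
  frontier_subset_closure (by rw [h.frontier_fluid]; exact Or.inl hp)

theorem integrableOn_mul_wrench (h : IsConfiguration W B k η₀) {f : Space → ℝ}
    (hf : ContinuousOn f (frontier B)) (i : Idx) :
    IntegrableOn (fun l => f l * wrench (bodyNormal B l) l i) (frontier B) area := by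
  have hN : ContinuousOn (bodyNormal B) (frontier B) := by
    have := h.body_smooth.continuousOn_outwardNormal.neg
    rwa [frontier_compl] at this
  have := h.body_smooth.integrableOn_frontier h.body_compact
    (φ := fun l => f l * wrench (bodyNormal B l) l i)
    (by rw [frontier_compl]; exact hf.mul (continuousOn_wrench hN i))
    (fun x hx => absurd (h.frontier_body_subset (by rw [← frontier_compl]; exact hx.1)) hx.2)
  rwa [frontier_compl] at this

end IsConfiguration

theorem IB_congr {B : Set Space} {f g : Space → ℝ} (hfg : EqOn f g (frontier B)) :
    IB B f = IB B g := by
  funext i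
  rw [IB, IB]
  congr 1
  exact setIntegral_congr_fun isClosed_frontier.measurableSet fun l hl => by
    simp only [hfg hl]

theorem IF_congr {W : Set Space} {f g : Space → ℝ} (hfg : EqOn f g (frontier W)) :
    IF W f = IF W g := by
  funext i
  exact setIntegral_congr_fun isClosed_frontier.measurableSet fun l hl => by
    simp only [hfg hl]

theorem IsConfiguration.IB_sum {W B : Set Space} {k : Space} {η₀ : ℝ}
    (h : IsConfiguration W B k η₀) {ι : Type*} (s : Finset ι) (c : ι → ℝ) {f : ι → Space → ℝ}
    (hf : ∀ j, ContinuousOn (f j) (frontier B)) :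
    IB B (fun l => ∑ j ∈ s, c j * f j l) = ∑ j ∈ s, c j • IB B (f j) := by
  funext i
  simp only [IB, Finset.sum_apply, Pi.smul_apply, smul_eq_mul, mul_neg, Finset.sum_neg_distrib]
  congr 1
  simp_rw [Finset.sum_mul, mul_assoc]
  rw [integral_finsetSum _ fun j _ => (h.integrableOn_mul_wrench (hf j) i).const_mul (c j)]
  exact Finset.sum_congr rfl fun j _ => integral_const_mul _ _

theorem IsConfiguration.IB_add {W B : Set Space} {k : Space} {η₀ : ℝ}
    (h : IsConfiguration W B k η₀) {f g : Space → ℝ} (hf : ContinuousOn f (frontier B))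
    (hg : ContinuousOn g (frontier B)) : IB B (f + g) = IB B f + IB B g := by
  funext i
  simp only [IB, Pi.add_apply, add_mul]
  rw [integral_add (h.integrableOn_mul_wrench hf i) (h.integrableOn_mul_wrench hg i), neg_add]

theorem IB_neg (B : Set Space) (f : Space → ℝ) : IB B (-f) = -IB B f := by
  funext i
  simp only [IB, Pi.neg_apply, neg_mul, integral_neg]

/-! ### Solutions of the mixed problem -/

namespace IsMixedSolution

variable {W B : Set Space} {k : Space} {η₀ : ℝ} {u u₁ u₂ : Idx → ℝ} {φ φ₁ φ₂ Φ Φ₁ Φ₂ : Space → ℝ}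

theorem continuousOn_body (h : IsConfiguration W B k η₀) (hΦ : IsMixedSolution W B u φ Φ) :
    ContinuousOn Φ (frontier B) :=
  hΦ.smooth.continuousOn.mono h.frontier_body_subset_closure

theorem add (h : IsConfiguration W B k η₀) (h₁ : IsMixedSolution W B u₁ φ₁ Φ₁)
    (h₂ : IsMixedSolution W B u₂ φ₂ Φ₂) :
    IsMixedSolution W B (u₁ + u₂) (φ₁ + φ₂) (Φ₁ + Φ₂) where
  smooth := h₁.smooth.add h₂.smooth
  harmonic x hx := (h₁.harmonic x hx).add (h₂.harmonic x hx)
  dirichlet l hl := by rw [Pi.add_apply, Pi.add_apply, h₁.dirichlet l hl, h₂.dirichlet l hl]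
  neumann l hl := by
    have hl' := h.frontier_body_subset_closure hl
    rw [fderivWithin_add (h.isSmoothDomain_fluid.uniqueDiffOn_closure l hl')
      (h₁.smooth.differentiableOn (by simp) l hl') (h₂.smooth.differentiableOn (by simp) l hl'),
      add_apply, h₁.neumann l hl, h₂.neumann l hl, rigidVelocity_add, inner_add_left]
  decay := by
    have := h₁.decay.add h₂.decay
    rwa [add_zero] at this

theorem const_smul (h : IsConfiguration W B k η₀) (c : ℝ) (h₁ : IsMixedSolution W B u φ Φ) :
    IsMixedSolution W B (c • u) (c • φ) (c • Φ) where
  smooth := h₁.smooth.const_smul c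
  harmonic x hx := (h₁.harmonic x hx).const_smul
  dirichlet l hl := by rw [Pi.smul_apply, Pi.smul_apply, h₁.dirichlet l hl]
  neumann l hl := by
    have hl' := h.frontier_body_subset_closure hl
    rw [fderivWithin_const_smul (h.isSmoothDomain_fluid.uniqueDiffOn_closure l hl')
      (h₁.smooth.differentiableOn (by simp) l hl'),
      smul_apply, h₁.neumann l hl, rigidVelocity_smul, real_inner_smul_left, smul_eq_mul]
  decay := by
    have := h₁.decay.const_smul c
    rwa [smul_zero] at this

theorem neg (h : IsConfiguration W B k η₀) (h₁ : IsMixedSolution W B u φ Φ) :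
    IsMixedSolution W B (-u) (-φ) (-Φ) := by
  simpa using h₁.const_smul h (-1)

theorem zero (h : IsConfiguration W B k η₀) (h₁ : IsMixedSolution W B u φ Φ) :
    IsMixedSolution W B 0 0 0 := by
  simpa using h₁.const_smul h 0

theorem sum (h : IsConfiguration W B k η₀) {ι : Type*} [Nonempty ι] (s : Finset ι) (c : ι → ℝ)
    {v : ι → Idx → ℝ} {φ Φ : ι → Space → ℝ} (hs : ∀ j, IsMixedSolution W B (v j) (φ j) (Φ j)) :
    IsMixedSolution W B (∑ j ∈ s, c j • v j) (fun l => ∑ j ∈ s, c j * φ j l)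
      (fun l => ∑ j ∈ s, c j * Φ j l) := by
  classical
  induction s using Finset.induction_on with
  | empty =>
    simp only [Finset.sum_empty]
    exact (hs (Classical.arbitrary ι)).zero h
  | insert j s hj ih =>
    simp_rw [Finset.sum_insert hj]
    exact ((hs j).const_smul h (c j)).add h ih

theorem isSurfaceData (h : IsConfiguration W B k η₀) (hΦ : IsMixedSolution W B u φ Φ) :
    IsSurfaceData W Φ :=
  ⟨hΦ.smooth.mono h.frontier_surface_subset_closure,
    hΦ.decay.mono_left (inf_le_inf_left _ (principal_mono.2 h.frontier_surface_subset_closure))⟩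

theorem isDecayingHarmonic (hΦ : IsMixedSolution W B u φ Φ) : IsDecayingHarmonic (W \ B) Φ :=
  ⟨hΦ.smooth, hΦ.harmonic, hΦ.decay⟩

/-- The fluid momentum `I_B` induced by the motion of the body is a symmetric function of the
motions, as long as the free surface carries no potential. -/
theorem integral_mul_rigidVelocity_comm (h : IsConfiguration W B k η₀)
    (h₁ : IsMixedSolution W B u₁ 0 Φ₁) (h₂ : IsMixedSolution W B u₂ 0 Φ₂) :
    ∫ l in frontier B, Φ₁ l * ⟪rigidVelocity u₂ l, bodyNormal B l⟫ ∂area =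
      ∫ l in frontier B, Φ₂ l * ⟪rigidVelocity u₁ l, bodyNormal B l⟫ ∂area := by
  have hz : ∀ {u Φ}, IsMixedSolution W B u 0 Φ → ∀ l ∈ frontier (W \ B) \ frontier B, Φ l = 0 := by
    rintro u Φ hΦ l ⟨hl, hl'⟩
    rw [h.frontier_fluid] at hl
    exact hΦ.dirichlet l (hl.resolve_right hl')
  have hsub : frontier B ⊆ frontier (W \ B) := by rw [h.frontier_fluid]; exact subset_union_right
  have hK : IsCompact (frontier B) :=
    h.body_compact.of_isClosed_subset isClosed_frontier h.frontier_body_subset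
  have hconv : ∀ {u u' Φ Φ'}, IsMixedSolution W B u 0 Φ → IsMixedSolution W B u' 0 Φ' →
      ∫ l in frontier (W \ B), Φ l *
        fderivWithin ℝ Φ' (closure (W \ B)) l (outwardNormal (W \ B) l) ∂area =
      -∫ l in frontier B, Φ l * ⟪rigidVelocity u' l, bodyNormal B l⟫ ∂area := by
    intro u u' Φ Φ' hΦ hΦ'
    rw [setIntegral_eq_of_subset_of_forall_sdiff_eq_zero isClosed_frontier.measurableSet hsub
      (fun l hl => by rw [hz hΦ l hl, zero_mul]), ← integral_neg]
    refine setIntegral_congr_fun isClosed_frontier.measurableSet fun l hl => ?_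
    rw [← hΦ'.neumann l hl, h.bodyNormal_eq hl, map_neg]
    ring
  have key := h.isSmoothDomain_fluid.integral_mul_normalDeriv_comm h₁.isDecayingHarmonic
    h₂.isDecayingHarmonic hK (hz h₁) (hz h₂)
  rw [hconv h₁ h₂, hconv h₂ h₁] at key
  exact neg_injective key

end IsMixedSolution

namespace IsKirchhoffPotential

variable {W B : Set Space} {k : Space} {η₀ : ℝ} {u u₁ u₂ : Idx → ℝ} {Φ Φ₁ Φ₂ : Space → ℝ}

/-- A Kirchhoff potential solves the mixed problem with its own surface values. -/
theorem isMixedSolution (h : IsConfiguration W B k η₀) (hΦ : IsKirchhoffPotential B u Φ) :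
    IsMixedSolution W B u Φ Φ where
  smooth := hΦ.smooth.mono (closure_mono fun _ hx => hx.2)
  harmonic := hΦ.harmonic.mono fun _ hx => hx.2
  dirichlet _ _ := rfl
  neumann l hl := by
    rw [fderivWithin_congr_set (h.closure_fluid_eventuallyEq (h.frontier_body_subset hl))]
    exact hΦ.neumann l hl
  decay := hΦ.decay.mono_left inf_le_left

theorem integral_mul_rigidVelocity_comm (h : IsConfiguration W B k η₀)
    (h₁ : IsKirchhoffPotential B u₁ Φ₁) (h₂ : IsKirchhoffPotential B u₂ Φ₂) :
    ∫ l in frontier B, Φ₁ l * ⟪rigidVelocity u₂ l, bodyNormal B l⟫ ∂area =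
      ∫ l in frontier B, Φ₂ l * ⟪rigidVelocity u₁ l, bodyNormal B l⟫ ∂area := by
  have hdec : ∀ {u Φ}, IsKirchhoffPotential B u Φ → IsDecayingHarmonic Bᶜ Φ := fun hΦ =>
    ⟨hΦ.smooth, hΦ.harmonic, hΦ.decay.mono_left inf_le_left⟩
  have hz : ∀ {Φ : Space → ℝ}, ∀ x ∈ frontier Bᶜ \ B, Φ x = 0 := fun x hx =>
    absurd (h.frontier_body_subset (by rw [← frontier_compl]; exact hx.1)) hx.2
  have hconv : ∀ {u : Idx → ℝ} {Φ Φ' : Space → ℝ}, IsKirchhoffPotential B u Φ' →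
      ∫ l in frontier Bᶜ, Φ l *
        fderivWithin ℝ Φ' (closure Bᶜ) l (outwardNormal Bᶜ l) ∂area =
      -∫ l in frontier B, Φ l * ⟪rigidVelocity u l, bodyNormal B l⟫ ∂area := by
    intro u Φ Φ' hΦ'
    rw [frontier_compl, ← integral_neg]
    refine setIntegral_congr_fun isClosed_frontier.measurableSet fun l hl => ?_
    rw [← hΦ'.neumann l hl, bodyNormal, map_neg]
    ring
  have key := h.body_smooth.integral_mul_normalDeriv_comm (hdec h₁) (hdec h₂) h.body_compact
    hz hz
  rw [hconv h₂, hconv h₁] at key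
  exact neg_injective key

end IsKirchhoffPotential

theorem LK_single (Ψ : Idx → Space → ℝ) (j : Idx) : LK Ψ (Pi.single j 1) = Ψ j := by
  funext l
  rw [LK, Finset.sum_eq_single j (fun i _ hij => by simp [Pi.single_eq_of_ne hij]) (by simp)]
  simp

theorem sum_smul_single (u : Idx → ℝ) : ∑ j, u j • (Pi.single j 1 : Idx → ℝ) = u := by
  funext i
  simp [Finset.sum_apply, Pi.single_apply]

/-! ### The mass matrices -/

section Matrices

variable {W B : Set Space} {k : Space} {η₀ : ℝ} {Ψ : Idx → Space → ℝ}

theorem MixedProblemWellPosed.LS_spec (hmixed : MixedProblemWellPosed W B) {φ : Space → ℝ}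
    (hφ : IsSurfaceData W φ) : IsMixedSolution W B 0 φ (LS W B φ) := by
  obtain ⟨Φ, hΦ, -⟩ := hmixed 0 φ hφ
  have hex : ∃ Φ, IsMixedSolution W B 0 φ Φ := ⟨Φ, hΦ⟩
  rw [LS, dif_pos hex]
  exact hex.choose_spec

theorem MixedProblemWellPosed.eqOn (hmixed : MixedProblemWellPosed W B) {u : Idx → ℝ}
    {φ Φ Φ' : Space → ℝ} (hφ : IsSurfaceData W φ) (h : IsMixedSolution W B u φ Φ)
    (h' : IsMixedSolution W B u φ Φ') : EqOn Φ Φ' (closure (W \ B)) := by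
  obtain ⟨Φ₀, -, huniq⟩ := hmixed u φ hφ
  exact (huniq Φ h).trans (huniq Φ' h').symm

theorem isMixedSolution_LK (h : IsConfiguration W B k η₀)
    (hΨ : ∀ i, IsKirchhoffPotential B (Pi.single i 1) (Ψ i)) (u : Idx → ℝ) :
    IsMixedSolution W B u (LK Ψ u) (LK Ψ u) := by
  have := IsMixedSolution.sum h Finset.univ u fun j => (hΨ j).isMixedSolution h
  rwa [sum_smul_single] at this

theorem IB_LK (h : IsConfiguration W B k η₀)
    (hΨ : ∀ i, IsKirchhoffPotential B (Pi.single i 1) (Ψ i)) (u : Idx → ℝ) :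
    IB B (LK Ψ u) = (massA B Ψ).mulVec u := by
  have hsum := h.IB_sum Finset.univ u (f := Ψ)
    fun j => ((hΨ j).isMixedSolution h).continuousOn_body h
  have hLK : LK Ψ u = fun l => ∑ j, u j * Ψ j l := rfl
  rw [hLK, hsum]
  funext i
  simp only [Finset.sum_apply, Pi.smul_apply, smul_eq_mul, Matrix.mulVec, dotProduct, massA,
    Matrix.of_apply, LK_single]
  exact Finset.sum_congr rfl fun j _ => mul_comm _ _

theorem neg_IB_LS_LK (h : IsConfiguration W B k η₀) (hmixed : MixedProblemWellPosed W B)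
    (hΨ : ∀ i, IsKirchhoffPotential B (Pi.single i 1) (Ψ i)) (u : Idx → ℝ) :
    -IB B (LS W B (LK Ψ u)) = (massC W B Ψ).mulVec u := by
  have hS : ∀ j, IsMixedSolution W B 0 (Ψ j) (LS W B (Ψ j)) := fun j =>
    hmixed.LS_spec (((hΨ j).isMixedSolution h).isSurfaceData h)
  have hdata := (isMixedSolution_LK h hΨ u).isSurfaceData h
  have hsol := IsMixedSolution.sum h Finset.univ u hS
  simp only [smul_zero, Finset.sum_const_zero] at hsol
  have heq := hmixed.eqOn hdata (hmixed.LS_spec hdata) hsol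
  rw [IB_congr (heq.mono h.frontier_body_subset_closure),
    h.IB_sum Finset.univ u fun j => (hS j).continuousOn_body h]
  funext i
  simp only [Pi.neg_apply, Finset.sum_apply, Pi.smul_apply, smul_eq_mul, Matrix.mulVec,
    dotProduct, massC, Matrix.of_apply, LK_single, neg_mul, Finset.sum_neg_distrib]
  rw [neg_inj]
  exact Finset.sum_congr rfl fun j _ => mul_comm _ _

/-- The potential due to the motion of the body when the free surface carries no potential. -/
theorem isMixedSolution_LK_sub_LS (h : IsConfiguration W B k η₀)
    (hmixed : MixedProblemWellPosed W B)
    (hΨ : ∀ i, IsKirchhoffPotential B (Pi.single i 1) (Ψ i)) (u : Idx → ℝ) :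
    IsMixedSolution W B u 0 (LK Ψ u + -LS W B (LK Ψ u)) := by
  have hK := isMixedSolution_LK h hΨ u
  have := hK.add h ((hmixed.LS_spec (hK.isSurfaceData h)).neg h)
  rwa [neg_zero, add_zero, add_neg_cancel] at this

theorem IB_eq_mulVec (h : IsConfiguration W B k η₀) (hmixed : MixedProblemWellPosed W B)
    (hΨ : ∀ i, IsKirchhoffPotential B (Pi.single i 1) (Ψ i)) {u : Idx → ℝ} {Φ : Space → ℝ}
    (hΦ : IsMixedSolution W B u 0 Φ) : IB B Φ = (massA B Ψ + massC W B Ψ).mulVec u := by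
  have hK := isMixedSolution_LK h hΨ u
  have hS := (hmixed.LS_spec (hK.isSurfaceData h)).neg h
  have heq := hmixed.eqOn ((hΦ.zero h).isSurfaceData h) hΦ
    (isMixedSolution_LK_sub_LS h hmixed hΨ u)
  rw [IB_congr (heq.mono h.frontier_body_subset_closure),
    h.IB_add (hK.continuousOn_body h) (hS.continuousOn_body h), IB_neg,
    IB_LK h hΨ, neg_IB_LS_LK h hmixed hΨ, Matrix.add_mulVec]

theorem massA_isSymm (h : IsConfiguration W B k η₀)
    (hΨ : ∀ i, IsKirchhoffPotential B (Pi.single i 1) (Ψ i)) : (massA B Ψ).IsSymm := by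
  refine Matrix.IsSymm.ext fun i j => ?_
  simp only [massA, Matrix.of_apply, LK_single, IB, ← inner_rigidVelocity_single]
  rw [(hΨ i).integral_mul_rigidVelocity_comm h (hΨ j)]

theorem massA_add_massC_isSymm (h : IsConfiguration W B k η₀)
    (hmixed : MixedProblemWellPosed W B)
    (hΨ : ∀ i, IsKirchhoffPotential B (Pi.single i 1) (Ψ i)) :
    (massA B Ψ + massC W B Ψ).IsSymm := by
  have hG := fun j => isMixedSolution_LK_sub_LS h hmixed hΨ (Pi.single j 1)
  have hentry : ∀ i j, (massA B Ψ + massC W B Ψ) i j =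
      IB B (LK Ψ (Pi.single j 1) + -LS W B (LK Ψ (Pi.single j 1))) i := by
    intro i j
    rw [IB_eq_mulVec h hmixed hΨ (hG j), Matrix.mulVec_single_one, Matrix.col_apply]
  refine Matrix.IsSymm.ext fun i j => ?_
  rw [hentry, hentry]
  simp only [IB, ← inner_rigidVelocity_single]
  rw [(hG i).integral_mul_rigidVelocity_comm h (hG j)]

theorem massC_isSymm (h : IsConfiguration W B k η₀) (hmixed : MixedProblemWellPosed W B)
    (hΨ : ∀ i, IsKirchhoffPotential B (Pi.single i 1) (Ψ i)) : (massC W B Ψ).IsSymm := by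
  have := (massA_add_massC_isSymm h hmixed hΨ).sub (massA_isSymm h hΨ)
  rwa [add_sub_cancel_left] at this

theorem massB_isSymm (B : Set Space) : (massB B).IsSymm := by
  refine Matrix.IsSymm.fromBlocks ((Matrix.isSymm_one).smul _) (by simp) ?_
  refine Matrix.IsSymm.ext fun i j => ?_
  simp only [Matrix.of_apply, eq_comm (a := j), mul_comm (_ : ℝ)]

/-! ### Independent variations -/

/-- With no potential on the free surface, the momenta are `ρ M u`. -/
theorem VariationPossible.exists_mulVec_eq (h : IsConfiguration W B k η₀)
    (hmixed : MixedProblemWellPosed W B)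
    (hΨ : ∀ i, IsKirchhoffPotential B (Pi.single i 1) (Ψ i)) {ρ : ℝ} {δp : Idx → ℝ}
    (hv : VariationPossible W B ρ 0 δp) :
    ∃ u, (massB B + massA B Ψ + massC W B Ψ).mulVec u = δp := by
  obtain ⟨δu, δΦ, hΦ, hp⟩ := hv
  have hIF : IF W δΦ = 0 := by
    rw [IF_congr (g := 0) fun l hl => hΦ.dirichlet l hl]
    funext i
    simp [IF]
  refine ⟨ρ • δu, ?_⟩
  rw [hp, hIF, add_zero, IB_eq_mulVec h hmixed hΨ hΦ, Matrix.mulVec_smul, add_assoc,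
    Matrix.add_mulVec, smul_add]

theorem variationPossible_of_isUnit (h : IsConfiguration W B k η₀)
    (hmixed : MixedProblemWellPosed W B)
    (hΨ : ∀ i, IsKirchhoffPotential B (Pi.single i 1) (Ψ i)) {ρ : ℝ} (hρ : 0 < ρ)
    (hM : IsUnit (massB B + massA B Ψ + massC W B Ψ)) {δφ : Space → ℝ}
    (hφ : IsSurfaceData W δφ) (δp : Idx → ℝ) : VariationPossible W B ρ δφ δp := by
  have hS := hmixed.LS_spec hφ
  obtain ⟨u, hu⟩ := Matrix.mulVec_surjective_iff_isUnit.2 hM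
    (ρ⁻¹ • δp - IB B (LS W B δφ) - IF W δφ)
  have hG := isMixedSolution_LK_sub_LS h hmixed hΨ u
  have hsol := hG.add h hS
  rw [add_zero, zero_add] at hsol
  refine ⟨u, _, hsol, ?_⟩
  rw [IF_congr (g := δφ) fun l hl => hsol.dirichlet l hl,
    h.IB_add (hG.continuousOn_body h) (hS.continuousOn_body h),
    IB_eq_mulVec h hmixed hΨ hG, ← smul_add]
  rw [add_assoc, Matrix.add_mulVec] at hu
  have : (massB B).mulVec u + ((massA B Ψ + massC W B Ψ).mulVec u + IB B (LS W B δφ) + IF W δφ) =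
      ρ⁻¹ • δp := by
    rw [add_assoc, ← add_assoc, hu]
    abel
  rw [this, smul_smul, mul_inv_cancel₀ hρ.ne', one_smul]

end Matrices

end FreeSurfaceBody

open FreeSurfaceBody
theorem mainTheorem4
    (W B : Set Space) (k : Space) (η₀ : ℝ) (hconf : IsConfiguration W B k η₀)
    (hmixed : MixedProblemWellPosed W B)
    (Ψ : Idx → Space → ℝ) (hΨ : ∀ i, IsKirchhoffPotential B (Pi.single i 1) (Ψ i))
    (ρ : ℝ) (hρ : 0 < ρ)
    (u₀ : Idx → ℝ) (φ₀ Φ₀ : Space → ℝ) (hφ₀ : IsSurfaceData W φ₀)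
    (hΦ₀ : IsMixedSolution W B u₀ φ₀ Φ₀) :
    (∀ u : Idx → ℝ, IB B (LK Ψ u) = (massA B Ψ).mulVec u) ∧
    (∀ u : Idx → ℝ, -IB B (LS W B (LK Ψ u)) = (massC W B Ψ).mulVec u) ∧
    (massA B Ψ).IsSymm ∧
    (massC W B Ψ).IsSymm ∧
    (massB B + massA B Ψ + massC W B Ψ).IsSymm ∧
    (IndependentVariationsPossible W B ρ Φ₀ ↔
      IsUnit (massB B + massA B Ψ + massC W B Ψ)) := by
  have hzero : IsSurfaceData W 0 := (hΦ₀.zero hconf).isSurfaceData hconf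
  refine ⟨IB_LK hconf hΨ, neg_IB_LS_LK hconf hmixed hΨ, massA_isSymm hconf hΨ,
    massC_isSymm hconf hmixed hΨ, ?_, fun hind => ?_, fun hM => ?_⟩
  · rw [add_assoc]
    exact (massB_isSymm B).add (massA_add_massC_isSymm hconf hmixed hΨ)
  · rw [← Matrix.mulVec_surjective_iff_isUnit]
    intro y
    obtain ⟨u, hu⟩ := (hind.linear fun i => y (Sum.inl i)).exists_mulVec_eq hconf hmixed hΨ
    obtain ⟨v, hv⟩ := (hind.angular fun i => y (Sum.inr i)).exists_mulVec_eq hconf hmixed hΨ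
    refine ⟨u + v, ?_⟩
    rw [Matrix.mulVec_add, hu, hv]
    funext i
    rcases i with i | i <;> simp
  · exact ⟨fun δL => variationPossible_of_isUnit hconf hmixed hΨ hρ hM hzero _,
      fun δA => variationPossible_of_isUnit hconf hmixed hΨ hρ hM hzero _,
      fun δφ hφ _ => variationPossible_of_isUnit hconf hmixed hΨ hρ hM hφ _,
      fun _ δφ _ _ hφ _ => variationPossible_of_isUnit hconf hmixed hΨ hρ hM hφ _⟩
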